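/- **Blocks.** A block is the genesis block $\mathbf g$, or it has a parent block, a finite list of reference blocks, a content and a nonce. $\mathbf b.\mathsf{past}$ is the set of all direct and indirect dependencies of $\mathbf b$ (through parents and references; $\mathbf b$ excluded), $\mathrm{Chain}(\mathbf b)$ is the path of parent links from $\mathbf g$ to $\mathbf b$, and $\mathbf b_1\preceq\mathbf b_2$ means $\mathbf b_1\in\mathrm{Chain}(\mathbf b_2)$. A graph is a finite set of blocks that contains $\mathbf g$ and is closed under $\mathsf{past}$. For a finite set $\mathbf B$ of blocks, $\mathrm{SubT}(\mathbf B,\mathbf b)=\{\mathbf b'\in\mathbf B:\mathbf b\preceq\mathbf b'\}$, $\mathrm{TotalW}$ is total weight, $\mathrm{SubTW}(\mathbf B,\mathbf b)=\mathrm{TotalW}(\mathrm{SubT}(\mathbf B,\mathbf b))$, $\mathrm{Chldn}(\mathbf B,\mathbf b)$ is the set of children of $\mathbf b$ in $\mathbf B$ of positive weight, and $\mathrm{SibSubTW}(\mathbf B,\mathbf b)$ is the maximum of $\mathrm{SubTW}(\mathbf B,\mathbf b')$ over $\mathbf b'\in\mathrm{Chldn}(\mathbf B,\mathbf b.\mathsf{parent})\setminus\{\mathbf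 b\}$ ($0$ if there is none). $\mathrm{Pivot}(\mathbf B)$ is the chain that starts at $\mathbf g$ and repeatedly moves to the child in $\mathrm{Chldn}$ with the largest $\mathrm{SubTW}$ (ties: minimum digest). **Age and weight.** Let $\mathcal H,\mathcal H^{\sf weight},\mathcal H^{\sf timer}$ be arbitrary hash functions with values in $\{0,\dots,2^\kappa-1\}$; the digest of a block is its value under $\mathcal H$. Timer blocks are those with $\mathcal H^{\sf timer}(\text{digest})<2^\kappa/\eta_{\sf t}$; $\mathrm{TimerHeight}(\mathbf b)=1+\max$ of the timer heights of the timer blocks in $\mathbf b.\mathsf{past}$, $\mathrm{MaxTH}(\mathbf B)$ is the maximum timer height of a timer block in $\mathbf B$ ($\max\emptyset=0$), and $\mathrm{Old}(\mathbf B,\mathbf b)$ means $\mathrm{MaxTH}(\mathbf B)-\mathrm{TimerHeight}(\mathbf b)\ge\eta_{\sf b}$. $\mathrm{Adapt}(\mathbf B)={\sf con}$ if $\mathbf B\ne\emptyset$ and either some $\mathbf b\in\mathrm{Pivot}(\mathbf B)\setminus\{\mathbf g\}$ has $\mathrm{Old}(\mathbf B,\mathbf b.\mathsf{parent})$ and $\mathrm{SubTW}(\mathbf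 B,\mathbf b)-\mathrm{SibSubTW}(\mathbf B,\mathbf b)<\eta_{\sf a}$, or the last block of $\mathrm{Pivot}(\mathbf B)$ is old in $\mathbf B$; otherwise $\mathrm{Adapt}(\mathbf B)={\sf opt}$. The weight of $\mathbf b$ is $1$ if $\mathrm{Adapt}(\mathbf b.\mathsf{past})={\sf opt}$; otherwise it is $\eta_{\sf w}$ if $\mathcal H^{\sf weight}(\text{digest})<2^\kappa/\eta_{\sf w}$ and $0$ if not. A block $\mathbf b\neq\mathbf g$ is valid if its digest is $<2^\kappa/\eta_{\sf d}$ and $\mathrm{Pivot}(\mathbf b.\mathsf{past})\circ\mathbf b=\mathrm{Chain}(\mathbf b)$. **Executions.** Rounds are $0,\dots,r_{\max}$. In each round the adversary chooses the set of honest nodes; the local state of an honest node after the deliveries (phase 2) is a graph of blocks generated in earlier rounds; then (phase 3(a)) each honest node generates at most one block, which is valid and has the local state as its past, and adds it to its local state; then (phase 3(b)) the adversary generates valid blocks that depend on generated blocks only. A node that stays honest keeps its blocks, and a block in the local state of an honest node in round $r$ is in the local states of all honest nodes at and after phase 2 of round $r+d$. No block is generated twice. Events $e=(r,\mathbf b,t)$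 are: $\mathsf{hGenRls}$ (an honest node generates $\mathbf b$), $\mathsf{mGen}$ (the adversary generates $\mathbf b$), $\mathsf{mRls}$ (a malicious block $\mathbf b$ is for the first time in an honest local state) and $\mathsf{Arvl}$ ($d$ rounds after the $\mathsf{hGenRls}$ or $\mathsf{mRls}$ event of $\mathbf b$). They are listed by round, then phase ($\mathsf{mRls},\mathsf{Arvl}$; $\mathsf{hGenRls}$; $\mathsf{mGen}$), such that a block is generated, released and received after its dependencies, and released before it is received. **Adversary state.** $\mathcal S=(\mathbf G^{\sf gen},\mathbf G^{\sf max},\mathbf G^{\sf min},\mathbf M,\mathbf f,\mathbf C,\mathbf S,v)$, $\mathbf G^\Delta:=\mathbf G^{\sf max}\setminus\mathbf G^{\sf min}$; initially $(\{\mathbf g\},\{\mathbf g\},\{\mathbf g\},\emptyset,\bot,(\mathbf g),\emptyset,0)$. Let $s_{\sf m},s_{\sf h}\ge0$ be integers. Put $$\mathrm{Adv}(\mathcal S,\mathbf b)=\mathrm{SubTW}(\mathbf G^{\sf min}\cup\{\mathbf f\},\mathbf b)-\mathrm{SibSubTW}(\mathbf G^{\sf max},\mathbf b)\qquad(\{\bot\}:=\emptyset),$$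 and let $\mathrm{Spe}(\mathcal S)$ mean: $\mathrm{SubTW}(\mathbf G^\Delta\cap\mathbf M,\mathrm{Tip}(\mathbf C))\ge s_{\sf m}$, or $\mathbf G^\Delta\setminus\mathbf M$ has at least $s_{\sf h}$ blocks of weight $1$, or at least $3$ blocks of weight $\eta_{\sf w}$. Here $\mathrm{Tip}(\mathbf C)$ is the last block of $\mathbf C$ and $\mathrm{Next}(\mathbf C,\mathbf b)$ the block after $\mathbf b$ in $\mathbf C$, or $\bot$. An event $e$ turns $\mathcal S_{-1}$ into $\mathcal S$ as follows. * The block of $e$ is added to $\mathbf G^{\sf gen},\mathbf G^{\sf max}$ ($\mathsf{hGenRls}$), to $\mathbf G^{\sf gen},\mathbf M$ ($\mathsf{mGen}$), to $\mathbf G^{\sf max}$ ($\mathsf{mRls}$), to $\mathbf G^{\sf min}$ ($\mathsf{Arvl}$). * If $e$ is an $\mathsf{hGenRls}$ event of a block of weight $\eta_{\sf w}$: $\mathbf f$ becomes that block if $\mathrm{Spe}(\mathcal S_{-1})$ fails and $\mathbf G^\Delta_{-1}\setminus\mathbf M_{-1}$ has no block of weight $\eta_{\sf w}$; otherwise $\mathbf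 f$ becomes $\bot$. If $e$ is the $\mathsf{Arvl}$ event of $\mathbf f_{-1}$, $\mathbf f$ becomes $\bot$. Otherwise $\mathbf f=\mathbf f_{-1}$. * $\mathbf C$: start at $\mathbf g$ and repeatedly move to the child in $\mathrm{Chldn}(\mathbf G^{\sf max},\cdot)$ with $\mathrm{Adv}>0$ (for the updated $\mathbf G^{\sf max},\mathbf G^{\sf min},\mathbf f$); then cut off the suffix starting with the first $\mathbf b'$ such that $\mathrm{Tip}(\mathbf C_{-1})\prec\mathbf b'$ and $\mathrm{Adv}(\mathbf b')\le s_{\sf m}+s_{\sf h}$. * $\mathbf S=\mathbf S_{-1}\cup(\mathrm{SubT}(\mathbf G^\Delta,\mathrm{Tip}(\mathbf C))\cap\mathbf M)$ and $v=v_{-1}+\min\{s_{\sf m},\mathrm{TotalW}(\mathbf S\setminus\mathbf S_{-1})\}$. **Potential.** Let $\mathbf c=\mathrm{Next}(\mathbf C,\mathbf b)$ and let $\mathbf N$ be the set of blocks of weight $1$ in $\mathbf G^{\sf max}\setminus\mathbf M$. If $\mathbf b\in\mathbf C$ and $\mathrm{Old}(\mathbf G^{\sf min},\mathbf b)$, then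 $P(\mathcal S,\mathbf b)=P_{\sf with}+P_{\sf adv}+P_{\sf sp}$, where $P_{\sf with}=\mathrm{SubTW}(\mathbf G^{\sf gen}\setminus\mathbf G^{\sf max},\mathbf b)$, $P_{\sf adv}=P_{\sf sp}=0$ if $\mathbf c=\bot$, and otherwise $$P_{\sf adv}=s_{\sf h}+s_{\sf m}-\mathrm{Adv}(\mathcal S,\mathbf c)-\min\{\mathrm{TotalW}(\mathrm{SubT}(\mathbf G^\Delta,\mathbf c)\cap\mathbf N),s_{\sf h}\},\qquad P_{\sf sp}=\mathrm{TotalW}((\mathrm{SubT}(\mathbf G^\Delta,\mathbf c)\cap\mathbf M)\setminus\mathbf S).$$ In all other cases $P(\mathcal S,\mathbf b)=\bot$. **Event value.** $\Delta(\mathcal S_{-1},e)$ is $0$ for $\mathsf{mRls}$ and $\mathsf{Arvl}$, and the weight of the block for $\mathsf{mGen}$. For $\mathsf{hGenRls}$ of a block of weight $0$ it is $0$; of weight $1$, it is $0$ if $\mathrm{Spe}(\mathcal S_{-1})$ and $-1$ if not; of weight $\eta_{\sf w}$: if $\mathbf G^\Delta_{-1}\setminus\mathbf M_{-1}$ has no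 block of weight $\eta_{\sf w}$, it is $0$ if $\mathrm{Spe}(\mathcal S_{-1})$ and $2s_{\sf h}+2s_{\sf m}-\eta_{\sf w}$ if not; if it has one, it is $0$ if $\mathbf f_{-1}=\bot$ and $\eta_{\sf w}+s_{\sf m}$ if not. **Theorem.** Let $\eta_{\sf w}>0$, $\eta_{\sf b}\ge 0$ an integer, $2s_{\sf h}+2s_{\sf m}\le\eta_{\sf w}$ and $2s_{\sf m}+2s_{\sf h}+2\eta_{\sf w}\le\eta_{\sf a}$. Let $\mathcal S$ be an adversary state that appears in an execution after at least one event, let $\mathcal S_{-1}$ be the adversary state just before it, and let $e$ be the event that updates $\mathcal S_{-1}$ to $\mathcal S$. 1. For every block $\mathbf b$ with $P(\mathcal S_{-1},\mathbf b)\ne\bot$ and $P(\mathcal S,\mathbf b)\neq\bot$, $$(P(\mathcal S,\mathbf b)+v)-(P(\mathcal S_{-1},\mathbf b)+v_{-1})\le\Delta(\mathcal S_{-1},e).$$ 2. For every block $\mathbf b$ with $P(\mathcal S_{-1},\mathbf b)=\bot$, $P(\mathcal S,\mathbf b)\ne\bot$ and $\mathrm{Old}(\mathbf G^{\sf min}_{-1},\mathbf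 b)$, we have $P(\mathcal S_{-1},\mathrm{Tip}(\mathbf C_{-1}))\neq\bot$ and $$(P(\mathcal S,\mathbf b)+v)-(P(\mathcal S_{-1},\mathrm{Tip}(\mathbf C_{-1}))+v_{-1})\le\Delta(\mathcal S_{-1},e).$$ -/

import Mathlib

noncomputable section

open Classical

namespace Ghast

/-! ## Blocks and the tree-graph structure -/

/-- A block is the genesis block, or it carries a parent block, a finite list of reference blocks,
a content and a nonce. Hash pointers are identified with the blocks that they point to. -/
inductive Block : Type
  | genesis : Block
  | mk (parent : Block) (k : ℕ) (refs : Fin k → Block) (content nonce : List Bool) : Block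

namespace Block

/-- The parent block; `none` for the genesis block. -/
def parent : Block → Option Block
  | genesis => none
  | mk p _ _ _ _ => some p

/-- The past graph: all direct and indirect dependency blocks (the block itself is excluded). -/
def past : Block → Finset Block
  | genesis => ∅
  | mk p _ refs _ _ =>
      insert p p.past ∪ Finset.univ.biUnion fun i => insert (refs i) (refs i).past

/-- The chain from the genesis block to the given block, along parent links. -/
def chain : Block → List Block
  | genesis => [genesis]
  | mk p k refs c s => p.chain ++ [mk p k refs c s]

/-- A rank that decreases along dependencies; used for termination only. -/
def rank : Block → ℕ
  | genesis => 0
  | mk p _ refs _ _ => max p.rank (Finset.univ.sup fun i => (refs i).rank) + 1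

theorem rank_lt_of_mem_past {x b : Block} (h : x ∈ b.past) : x.rank < b.rank := by
  induction b with
  | genesis => simp [past] at h
  | mk p k refs c s ihp ihr =>
    have hp : p.rank < (mk p k refs c s).rank := by
      simp only [rank]; exact Nat.lt_succ_of_le (le_max_left _ _)
    have hr : ∀ i, (refs i).rank < (mk p k refs c s).rank := fun i => by
      simp only [rank]
      exact Nat.lt_succ_of_le (le_trans
        (Finset.le_sup (f := fun i => (refs i).rank) (Finset.mem_univ i)) (le_max_right _ _))
    simp only [past, Finset.mem_union, Finset.mem_insert, Finset.mem_biUnion, Finset.mem_univ,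
      true_and] at h
    rcases h with (rfl | h) | ⟨i, rfl | h⟩
    · exact hp
    · exact (ihp h).trans hp
    · exact hr i
    · exact (ihr i h).trans (hr i)

end Block

/-- `b₁ ⪯ b₂`: `b₁` lies on the chain of `b₂`. -/
def Preceq (b₁ b₂ : Block) : Prop := b₁ ∈ b₂.chain

/-- `b₁ ≺ b₂`. -/
def Prec (b₁ b₂ : Block) : Prop := Preceq b₁ b₂ ∧ b₁ ≠ b₂

/-- A (valid) graph: a finite set of blocks that contains the genesis block and all the
dependency blocks of its members. -/
def IsGraph (B : Finset Block) : Prop := Block.genesis ∈ B ∧ ∀ b ∈ B, b.past ⊆ B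

/-! ### Subtrees, children and pivot chain, for a given weight function `w` -/

/-- The subtree of `b` in `B`. -/
def subT (B : Finset Block) (b : Block) : Finset Block := B.filter fun x => Preceq b x

/-- The total weight of a set of blocks. -/
def totalW (w : Block → ℝ) (T : Finset Block) : ℝ := ∑ x ∈ T, w x

/-- The subtree weight of `b` in `B`. -/
def subTW (w : Block → ℝ) (B : Finset Block) (b : Block) : ℝ := totalW w (subT B b)

/-- The children of positive weight of a block (`none` stands for the absent parent of the
genesis block). -/
def chldn (w : Block → ℝ) (B : Finset Block) (p : Option Block) : Finset Block :=
  B.filter fun x => x.parent = p ∧ 0 < w x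

/-- The maximum subtree weight of the siblings of `b`, and `0` if `b` has no sibling. -/
def sibSubTW (w : Block → ℝ) (B : Finset Block) (b : Block) : ℝ :=
  if h : ((chldn w B b.parent).erase b).Nonempty then
    ((chldn w B b.parent).erase b).sup' h (subTW w B)
  else 0

/-- Starting from a block, repeatedly visit the successor; at most `n` moves. -/
def visit (next : Block → Option Block) : ℕ → Block → List Block
  | 0, b => [b]
  | n + 1, b =>
    match next b with
    | none => [b]
    | some c => b :: visit next n c

/-- The last block of a chain (chains are never empty). -/
def tip (C : List Block) : Block := C.getLastD Block.genesis

/-- The element after `b` in the chain `C`; `none` if `b` is the last one or not in `C`. -/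
def next (C : List Block) (b : Block) : Option Block := C[C.idxOf b + 1]?

/-! ## The protocol -/

/-- The parameters: the security parameter, the values of the hash oracles, the protocol
parameters, and the two integers `sm`, `sh` of the security analysis. -/
structure Params where
  κ : ℕ
  /-- The hash of `(parent digest, reference digests, content, nonce)`; the argument `none`
  stands for the tuple of the genesis block. -/
  H : Option (Fin (2 ^ κ) × List (Fin (2 ^ κ)) × List Bool × List Bool) → Fin (2 ^ κ)
  /-- The oracle for the weight tag of a digest. -/
  Hweight : Fin (2 ^ κ) → Fin (2 ^ κ)
  /-- The oracle for the timer tag of a digest. -/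
  Htimer : Fin (2 ^ κ) → Fin (2 ^ κ)
  /-- puzzle difficulty -/
  ηd : ℝ
  /-- weight of a heavy block in the conservative strategy -/
  ηw : ℝ
  /-- dominance threshold of `Adapt` -/
  ηa : ℝ
  /-- timer block difficulty -/
  ηt : ℝ
  /-- age threshold of `Old` -/
  ηb : ℕ
  sm : ℕ
  sh : ℕ

namespace Params

variable (π : Params)

/-- The digest of a block. -/
def digest : Block → Fin (2 ^ π.κ)
  | .genesis => π.H none
  | .mk p _ refs c s =>
      π.H (some (digest p, List.ofFn fun i => digest (refs i), c, s))

/-- The child with the largest subtree weight; ties are broken by the minimum digest. -/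
def bestChild (w : Block → ℝ) (B : Finset Block) (b : Block) : Option Block :=
  if h : ∃ c ∈ chldn w B (some b), ∀ c' ∈ chldn w B (some b),
      subTW w B c' < subTW w B c ∨
        (subTW w B c' = subTW w B c ∧ π.digest c ≤ π.digest c') then
    some h.choose
  else none

/-- The pivot chain of a graph. -/
def pivot (w : Block → ℝ) (B : Finset Block) : List Block :=
  visit (π.bestChild w B) B.card Block.genesis

/-- Timer blocks. -/
def IsTimer (b : Block) : Prop := ((π.Htimer (π.digest b) : ℕ) : ℝ) < 2 ^ π.κ / π.ηt

/-- One plus the maximum timer height of a timer block in the past graph (`1` if there is none);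
defined for every block. -/
def timerHeight (b : Block) : ℕ :=
  (b.past.attach.sup fun x => if π.IsTimer x.1 then timerHeight x.1 else 0) + 1
termination_by b.rank
decreasing_by exact Block.rank_lt_of_mem_past x.2

/-- The maximum timer height in `B` (`0` if there is no timer block in `B`). -/
def maxTH (B : Finset Block) : ℕ := (B.filter π.IsTimer).sup π.timerHeight

/-- The block age speculation function. -/
def Old (B : Finset Block) (b : Block) : Prop :=
  (π.ηb : ℤ) ≤ (π.maxTH B : ℤ) - (π.timerHeight b : ℤ)

/-- `Adapt(B) = con`: the conservative strategy is in force for a block with past graph `B`. -/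
def AdaptCon (w : Block → ℝ) (B : Finset Block) : Prop :=
  B.Nonempty ∧
    ((∃ b ∈ π.pivot w B, ∃ p, b.parent = some p ∧ π.Old B p ∧
        subTW w B b - sibSubTW w B b < π.ηa) ∨
      π.Old B (tip (π.pivot w B)))

/-- The weight of a block, when `con` says whether the conservative strategy is in force. -/
def weightIf (con : Prop) (b : Block) : ℝ :=
  if ¬ con then 1
  else if ((π.Hweight (π.digest b) : ℕ) : ℝ) < 2 ^ π.κ / π.ηw then π.ηw
  else 0

/-- The block weight, by recursion over the past graph: `Adapt` is evaluated on the past graph,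
where the weights are already known (see `weight_eq`). -/
def weight (b : Block) : ℝ :=
  π.weightIf (π.AdaptCon (fun x => if _h : x ∈ b.past then weight x else 0) b.past) b
termination_by b.rank
decreasing_by exact Block.rank_lt_of_mem_past _h

section congruence

variable {w w' : Block → ℝ} {B : Finset Block}

theorem subTW_congr (h : ∀ x ∈ B, w x = w' x) (b : Block) : subTW w B b = subTW w' B b :=
  Finset.sum_congr rfl fun x hx => h x (Finset.mem_filter.1 hx).1

theorem chldn_congr (h : ∀ x ∈ B, w x = w' x) (p : Option Block) :
    chldn w B p = chldn w' B p :=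
  Finset.filter_congr fun x hx => by rw [h x hx]

theorem AdaptCon_congr (h : ∀ x ∈ B, w x = w' x) : π.AdaptCon w B ↔ π.AdaptCon w' B := by
  have h1 : subTW w B = subTW w' B := funext (subTW_congr h)
  have h2 : chldn w B = chldn w' B := funext (chldn_congr h)
  have h3 : sibSubTW w B = sibSubTW w' B := by
    funext b; simp only [sibSubTW, h1, h2]
  have h4 : π.bestChild w B = π.bestChild w' B := by
    funext b; simp only [bestChild, h1, h2]
  have h5 : π.pivot w B = π.pivot w' B := by simp only [pivot, h4]
  simp only [AdaptCon, h1, h3, h5]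

end congruence

/-- The defining equation of the block weight. -/
theorem weight_eq (b : Block) :
    π.weight b = π.weightIf (π.AdaptCon π.weight b.past) b := by
  rw [weight]
  congr 1
  exact propext (π.AdaptCon_congr fun x hx => by simp [hx])

/-- Validity of a block other than the genesis block: it solves the proof-of-work puzzle, and its
chain is the pivot chain of its past graph followed by the block itself. -/
def Valid (b : Block) : Prop :=
  b ≠ Block.genesis ∧ ((π.digest b : ℕ) : ℝ) < 2 ^ π.κ / π.ηd ∧
    π.pivot π.weight b.past ++ [b] = b.chain

end Params

/-! ## Events and executions -/

/-- The four types of events. -/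
inductive EventType
  | hGenRls
  | mGen
  | mRls
  | arvl

/-- An event `(r, b, t)`. -/
structure Event where
  round : ℕ
  block : Block
  type : EventType

/-- The position of an event inside its round: deliveries happen in phase 2, honest nodes mine in
phase 3(a), the adversary mines in phase 3(b). -/
def EventType.phase : EventType → ℕ
  | .mRls => 0
  | .arvl => 0
  | .hGenRls => 1
  | .mGen => 2

/-- The event is the generation of its block. -/
def Event.IsGen (e : Event) : Prop := e.type = .hGenRls ∨ e.type = .mGen

/-- The event is the release of its block. -/
def Event.IsRls (e : Event) : Prop := e.type = .hGenRls ∨ e.type = .mRls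

/-- The constraints on the order of events: rounds and phases are in order, a block is generated
(released, received by all) after its dependency blocks, and it is released before it is received
by all. -/
def Event.MustPrecede (e e' : Event) : Prop :=
  e.round < e'.round ∨
  (e.round = e'.round ∧ e.type.phase < e'.type.phase) ∨
  ((e.type = e'.type ∨ (e.IsGen ∧ e'.IsGen)) ∧ e.block ∈ e'.block.past) ∨
  (e.IsRls ∧ e'.type = .arvl ∧ e.block = e'.block)

/-- An execution of the protocol in rounds `0, …, rmax` by the participant nodes `ι`, in the
presence of an adversary that corrupts nodes adaptively, generates and withholds blocks, and
delivers blocks with a delay of at most `d` rounds. No bound on the number of corrupted nodes or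
on the number of oracle queries of the adversary is imposed. -/
structure Execution (π : Params) (ι : Type*) where
  rmax : ℕ
  d : ℕ
  /-- The nodes that are honest in a round. -/
  honest : ℕ → Set ι
  /-- The local state of a node in a round, after the deliveries of phase 2. -/
  loc : ℕ → ι → Finset Block
  /-- The block (if any) that an honest node generates in phase 3(a) of a round. -/
  mined : ℕ → ι → Option Block
  /-- All the events, in their order. -/
  events : List Event
  /-- Local states of honest nodes are graphs. -/
  loc_isGraph : ∀ r ≤ rmax, ∀ i ∈ honest r, IsGraph (loc r i)
  /-- They consist of blocks that were generated in earlier rounds. -/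
  loc_generated : ∀ r ≤ rmax, ∀ i ∈ honest r, ∀ b ∈ loc r i, b ≠ Block.genesis →
    ∃ e ∈ events, e.IsGen ∧ e.block = b ∧ e.round < r
  /-- A node that stays honest keeps its local state and the block that it generated. -/
  loc_keep : ∀ r < rmax, ∀ i ∈ honest r, i ∈ honest (r + 1) →
    loc r i ∪ (mined r i).toFinset ⊆ loc (r + 1) i
  /-- A block in the local state of an honest node in round `r` belongs to the local states of all
  honest nodes at and after phase 2 of round `r + d`. -/
  delivery : ∀ r r', r + d ≤ r' → r' ≤ rmax → ∀ i ∈ honest r, ∀ j ∈ honest r',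
    loc r i ∪ (mined r i).toFinset ⊆ loc r' j
  /-- Honest nodes follow the protocol: they generate valid blocks whose past graph is their local
  state. -/
  mined_valid : ∀ r ≤ rmax, ∀ i ∈ honest r, ∀ b, mined r i = some b →
    π.Valid b ∧ b.past = loc r i
  /-- Honest block generation. -/
  hGenRls_iff : ∀ r b, (⟨r, b, .hGenRls⟩ : Event) ∈ events ↔
    r ≤ rmax ∧ ∃ i ∈ honest r, mined r i = some b
  /-- Malicious block generation: the block is valid and refers to generated blocks. -/
  mGen_valid : ∀ r b, (⟨r, b, .mGen⟩ : Event) ∈ events →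
    r ≤ rmax ∧ π.Valid b ∧
      ∀ x ∈ b.past, x ≠ Block.genesis → ∃ e ∈ events, e.IsGen ∧ e.block = x
  /-- Malicious block release: the first time that the block is in an honest local state. -/
  mRls_iff : ∀ r b, (⟨r, b, .mRls⟩ : Event) ∈ events ↔
    r ≤ rmax ∧ (∃ e ∈ events, e.type = .mGen ∧ e.block = b) ∧
      (∃ i ∈ honest r, b ∈ loc r i) ∧ ∀ r' < r, ∀ i ∈ honest r', b ∉ loc r' i
  /-- Block received by all honest nodes: `d` rounds after the release. -/
  arvl_iff : ∀ r b, (⟨r, b, .arvl⟩ : Event) ∈ events ↔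
    r ≤ rmax ∧ ∃ e ∈ events, e.IsRls ∧ e.block = b ∧ e.round + d = r
  /-- No event is listed twice, and no block is generated twice. -/
  nodup : events.Pairwise fun e e' => e ≠ e' ∧ (e.IsGen → e'.IsGen → e.block ≠ e'.block)
  /-- The events are listed in a possible order. -/
  ordered : events.Pairwise fun e e' => ¬ e'.MustPrecede e

/-! ## The adversary state -/

/-- The adversary state. -/
structure AdvState where
  /-- generated blocks -/
  gen : Finset Block
  /-- released blocks -/
  max : Finset Block
  /-- blocks received by all honest nodes -/
  min : Finset Block
  /-- malicious blocks -/
  M : Finset Block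
  /-- flag block -/
  f : Option Block
  /-- variant of the common pivot chain -/
  C : List Block
  /-- malicious blocks accounted for in the special status -/
  S : Finset Block
  v : ℝ

namespace AdvState

/-- The initial adversary state. -/
def init : AdvState where
  gen := {Block.genesis}
  max := {Block.genesis}
  min := {Block.genesis}
  M := ∅
  f := none
  C := [Block.genesis]
  S := ∅
  v := 0

/-- Released blocks that may be unknown to some honest nodes. -/
def delta (s : AdvState) : Finset Block := s.max \ s.min

end AdvState

namespace Params

variable (π : Params)

/-- `Adv((max, min, f), b)`. -/
def adv (max min : Finset Block) (f : Option Block) (b : Block) : ℝ :=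
  subTW π.weight (min ∪ f.toFinset) b - sibSubTW π.weight max b

/-- The special status. -/
def Spe (s : AdvState) : Prop :=
  (π.sm : ℝ) ≤ subTW π.weight (s.delta ∩ s.M) (tip s.C) ∨
  π.sh ≤ ((s.delta \ s.M).filter fun b => π.weight b = 1).card ∨
  3 ≤ ((s.delta \ s.M).filter fun b => π.weight b = π.ηw).card

/-- There is an honest block of weight `ηw` among the released blocks that may be unknown to some
honest nodes. -/
def HasHeavy (s : AdvState) : Prop := ∃ b ∈ s.delta \ s.M, π.weight b = π.ηw

/-- The new flag block. -/
def newFlag (s : AdvState) (e : Event) : Option Block :=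
  if π.weight e.block = π.ηw ∧ e.type = .hGenRls ∧ ¬ π.Spe s ∧ ¬ π.HasHeavy s then some e.block
  else if π.weight e.block = π.ηw ∧ e.type = .hGenRls ∧ s.f ≠ none then none
  else if s.f = some e.block ∧ e.type = .arvl then none
  else s.f

/-- The child of `b` in `max` with positive `Adv` (there is at most one in an execution). -/
def advChild (max min : Finset Block) (f : Option Block) (b : Block) : Option Block :=
  if h : ∃ c ∈ chldn π.weight max (some b), 0 < π.adv max min f c then some h.choose else none

/-- The new chain: follow the children with positive `Adv` from the genesis block on; then cut off
the suffix that starts with the first block `b'` such that `Tip(C₋) ≺ b'` and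
`Adv(b') ≤ sm + sh`. -/
def newChain (max min : Finset Block) (f : Option Block) (Cprev : List Block) : List Block :=
  (visit (π.advChild max min f) max.card Block.genesis).takeWhile fun b =>
    decide ¬ (Prec (tip Cprev) b ∧ π.adv max min f b ≤ π.sm + π.sh)

/-- The traverse function. -/
def ψ (s : AdvState) (e : Event) : AdvState :=
  let gen := if e.IsGen then insert e.block s.gen else s.gen
  let max := if e.IsRls then insert e.block s.max else s.max
  let min := if e.type = .arvl then insert e.block s.min else s.min
  let M := if e.type = .mGen then insert e.block s.M else s.M
  let f := π.newFlag s e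
  let C := π.newChain max min f s.C
  let S := s.S ∪ (subT (max \ min) (tip C) ∩ M)
  { gen := gen
    max := max
    min := min
    M := M
    f := f
    C := C
    S := S
    v := s.v + Min.min (π.sm : ℝ) (totalW π.weight (S \ s.S)) }

/-! ### Block potential and event values -/

/-- The weight that the adversary withholds under `b`. -/
def Pwith (s : AdvState) (b : Block) : ℝ := subTW π.weight (s.gen \ s.max) b

/-- The honest released blocks of weight `1`. -/
def lightHonest (s : AdvState) : Finset Block := (s.max \ s.M).filter fun b => π.weight b = 1

/-- The component `P_adv`, as a function of the next block `c` of the chain. -/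
def Padv (s : AdvState) : Option Block → ℝ
  | none => 0
  | some c => π.sh + π.sm - π.adv s.max s.min s.f c -
      Min.min (totalW π.weight (subT s.delta c ∩ π.lightHonest s)) π.sh

/-- The component `P_sp`. -/
def Psp (s : AdvState) (b : Block) : ℝ :=
  match next s.C b with
  | none => 0
  | some c => totalW π.weight ((subT s.delta c ∩ s.M) \ s.S)

/-- The block potential value; `none` stands for `⊥`. -/
def P (s : AdvState) (b : Block) : Option ℝ :=
  if b ∈ s.C ∧ π.Old s.min b then
    some (π.Pwith s b + π.Padv s (next s.C b) + π.Psp s b)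
  else none

/-- The event value. -/
def eventValue (s : AdvState) (e : Event) : ℝ :=
  match e.type with
  | .mRls => 0
  | .arvl => 0
  | .mGen => π.weight e.block
  | .hGenRls =>
    if π.weight e.block = 0 then 0
    else if π.weight e.block = 1 then (if π.Spe s then 0 else -1)
    else if ¬ π.HasHeavy s then (if π.Spe s then 0 else 2 * π.sh + 2 * π.sm - π.ηw)
    else if s.f = none then 0
    else π.ηw + π.sm

end Params

/-- The adversary state after the first `n` events of an execution. -/
def Execution.state {π : Params} {ι : Type*} (X : Execution π ι) (n : ℕ) : AdvState :=
  (X.events.take n).foldl π.ψ AdvState.init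

end Ghast

end

/-! The potential works like a ledger in which an event only moves weight. A malicious block
released under `b` leaves `Pwith`; its weight then appears at most once, either below the next chain
block `c`, where `Psp` counts it, or below a sibling of `c`, where it lowers `Adv(c)` and so raises
`Padv`. A received honest block of weight 1 below `c` leaves the capped term of `Padv` but raises
`Adv(c)` by the same amount. Malicious blocks that enter `S` pass from `Psp` to `v`. So release and
reception cost nothing, and a malicious generation costs its weight.

Two siblings cannot both have positive `Adv`, so the chain is controlled by inequalities, and events
are of two kinds. If `Adv` cannot increase, the chain can only lose a suffix (`stepBound_of_le`);
when `c` is cut off, the old `Padv`, at least `sm - Adv(c)`, pays for the growth of `v` by at most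
`sm`. If the old chain stays dominant, the chain can only grow (`stepBound_of_keep`); new blocks
exceed the threshold `sm + sh`, which makes `Padv` nonpositive, and the malicious blocks beyond the
old tip are already in `S`.

For honest generation, the network guarantees that the past graph of the block lies between `min`
and `max` (`Execution.admissible`). A block that beats its siblings with `min` against `max`
therefore lies on the chain of the honest block. Without a flag, the honest block extends the whole
chain (`StateInv.preceq_of_flag_none`). With a flag, a block of weight 1 still follows the old part,
since the optimistic strategy certifies a margin `ηa` that exceeds the flag's weight
(`StateInv.preceq_of_light`). Outside the special status it gains 1 under the cap `sh`, and the tip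
cannot be old, since `ηa` also exceeds the unknown weight by enough to prolong the chain
(`StateInv.not_old_tip_of_light`).

A new flag adds `ηw` to `Adv` along its own chain. Less than `sm + sh` is unknown at that moment and
`ηw` is at least `2 * (sm + sh)`, so the chain grows past every old block. A heavy block that clears
the flag costs at most `ηw`. -/

namespace Ghast

open Classical

/-! ## Chains -/

namespace Block

theorem chain_eq (b : Block) :
    b = genesis ∧ b.chain = [genesis] ∨ ∃ p, b.parent = some p ∧ b.chain = p.chain ++ [b] := by
  cases b with
  | genesis => exact .inl ⟨rfl, rfl⟩
  | mk p k refs c s => exact .inr ⟨p, rfl, rfl⟩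

theorem chain_of_parent {b p : Block} (h : b.parent = some p) : b.chain = p.chain ++ [b] := by
  cases b with
  | genesis => simp [parent] at h
  | mk q k refs c s =>
    simp only [parent, Option.some.injEq] at h
    subst h; rfl

theorem parent_mem_past {b p : Block} (h : b.parent = some p) : p ∈ b.past := by
  cases b with
  | genesis => simp [parent] at h
  | mk q k refs c s =>
    simp only [parent, Option.some.injEq] at h
    subst h; simp [past]

theorem rank_parent {b p : Block} (h : b.parent = some p) : p.rank < b.rank :=
  rank_lt_of_mem_past (parent_mem_past h)

theorem exists_parent {b : Block} (h : b ≠ genesis) : ∃ p, b.parent = some p := by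
  cases b with
  | genesis => exact absurd rfl h
  | mk p k refs c s => exact ⟨p, rfl⟩

theorem ne_genesis_of_parent {b p : Block} (h : b.parent = some p) : b ≠ genesis := by
  rintro rfl; simp [parent] at h

theorem past_subset_of_mem {x b : Block} (h : x ∈ b.past) : x.past ⊆ b.past := by
  induction b with
  | genesis => simp [past] at h
  | mk p k refs c s ihp ihr =>
    intro y hy
    simp only [past, Finset.mem_union, Finset.mem_insert, Finset.mem_biUnion, Finset.mem_univ,
      true_and] at h ⊢
    rcases h with (rfl | h) | ⟨i, rfl | h⟩
    · exact .inl (.inr hy)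
    · exact .inl (.inr (ihp h hy))
    · exact .inr ⟨i, .inr hy⟩
    · exact .inr ⟨i, .inr (ihr i h hy)⟩

/-- Induction along parent links. -/
@[elab_as_elim]
theorem parent_induction {motive : Block → Prop} (b : Block) (genesis : motive genesis)
    (step : ∀ b p, b.parent = some p → motive p → motive b) : motive b := by
  induction b with
  | genesis => exact genesis
  | mk p k refs c s ihp _ => exact step _ p rfl ihp

theorem mem_past_irrefl (b : Block) : b ∉ b.past := fun h => (rank_lt_of_mem_past h).false

end Block

open Block

theorem Preceq.refl (b : Block) : Preceq b b := by
  rcases chain_eq b with ⟨rfl, h⟩ | ⟨p, _, h⟩ <;> simp [Preceq, h]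

theorem preceq_genesis_iff {a : Block} : Preceq a genesis ↔ a = genesis := by
  simp [Preceq, chain]

theorem preceq_iff_of_parent {a b p : Block} (h : b.parent = some p) :
    Preceq a b ↔ Preceq a p ∨ a = b := by
  simp [Preceq, chain_of_parent h]

theorem genesis_preceq (b : Block) : Preceq genesis b := by
  induction b using parent_induction with
  | genesis => exact Preceq.refl _
  | step b p h ih => exact (preceq_iff_of_parent h).2 (.inl ih)

theorem Preceq.parent {a b p : Block} (h : b.parent = some p) (hb : Preceq b a) :
    Preceq p a := by
  induction a using parent_induction with
  | genesis =>
    rw [preceq_genesis_iff] at hb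
    exact absurd hb (ne_genesis_of_parent h)
  | step a q hq ih =>
    rw [preceq_iff_of_parent hq] at hb ⊢
    rcases hb with hb | rfl
    · exact .inl (ih hb)
    · rw [h] at hq; cases hq
      exact .inl (Preceq.refl _)

theorem Preceq.trans {a b c : Block} (hab : Preceq a b) (hbc : Preceq b c) : Preceq a c := by
  induction b using parent_induction with
  | genesis => rw [preceq_genesis_iff.1 hab]; exact genesis_preceq _
  | step b p h ih =>
    rcases (preceq_iff_of_parent h).1 hab with h' | rfl
    · exact ih h' (hbc.parent h)
    · exact hbc

theorem Preceq.mem_past {a b : Block} (h : Preceq a b) : a = b ∨ a ∈ b.past := by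
  induction b using parent_induction with
  | genesis => exact .inl (preceq_genesis_iff.1 h)
  | step b p hp ih =>
    rcases (preceq_iff_of_parent hp).1 h with h' | rfl
    · rcases ih h' with rfl | h''
      · exact .inr (parent_mem_past hp)
      · exact .inr (past_subset_of_mem (parent_mem_past hp) h'')
    · exact .inl rfl

theorem Preceq.rank_le {a b : Block} (h : Preceq a b) : a.rank ≤ b.rank := by
  rcases h.mem_past with rfl | h
  · exact le_rfl
  · exact (rank_lt_of_mem_past h).le

theorem not_preceq_parent {b p : Block} (h : b.parent = some p) : ¬ Preceq b p := fun hb =>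
  (hb.rank_le.trans_lt (rank_parent h)).false

theorem Preceq.antisymm {a b : Block} (h : Preceq a b) (h' : Preceq b a) : a = b :=
  h.mem_past.resolve_right fun ha => (h'.rank_le.trans_lt (rank_lt_of_mem_past ha)).false

theorem Preceq.total {a b x : Block} (ha : Preceq a x) (hb : Preceq b x) :
    Preceq a b ∨ Preceq b a := by
  induction x using parent_induction with
  | genesis => rw [preceq_genesis_iff.1 ha]; exact .inl (genesis_preceq _)
  | step x p h ih =>
    rcases (preceq_iff_of_parent h).1 ha with ha' | rfl
    · rcases (preceq_iff_of_parent h).1 hb with hb' | rfl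
      · exact ih ha' hb'
      · exact .inl ha
    · exact .inr hb

/-- A chain contains at most one child of each block. -/
theorem eq_of_preceq_of_parent {a b x p : Block} (ha : Preceq a x) (hb : Preceq b x)
    (hpa : a.parent = some p) (hpb : b.parent = some p) : a = b := by
  rcases ha.total hb with h | h
  · exact ((preceq_iff_of_parent hpb).1 h).resolve_left (not_preceq_parent hpa)
  · exact (((preceq_iff_of_parent hpa).1 h).resolve_left (not_preceq_parent hpb)).symm

theorem exists_child_of_preceq {a x : Block} (h : Preceq a x) (hne : a ≠ x) :
    ∃ c, c.parent = some a ∧ Preceq c x := by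
  induction x using parent_induction with
  | genesis => exact absurd (preceq_genesis_iff.1 h) hne
  | step x p hp ih =>
    have hap := ((preceq_iff_of_parent hp).1 h).resolve_right hne
    by_cases e : a = p
    · exact ⟨x, e ▸ hp, Preceq.refl _⟩
    · obtain ⟨c, hc, hcp⟩ := ih hap e
      exact ⟨c, hc, (preceq_iff_of_parent hp).2 (.inl hcp)⟩

theorem chain_nodup (b : Block) : b.chain.Nodup := by
  induction b using parent_induction with
  | genesis => simp [chain]
  | step b p h ih =>
    rw [chain_of_parent h, List.nodup_append]
    refine ⟨ih, by simp, fun a ha c hc => ?_⟩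
    rw [List.mem_singleton] at hc
    rintro rfl
    subst hc
    exact not_preceq_parent h ha

theorem tip_chain (b : Block) : tip b.chain = b := by
  rcases chain_eq b with ⟨rfl, h⟩ | ⟨p, _, h⟩ <;> rw [h] <;> simp [tip]

theorem chain_length_le_card {B : Finset Block} {b : Block} (h : ∀ a, Preceq a b → a ∈ B) :
    b.chain.length ≤ B.card := by
  rw [← List.toFinset_card_of_nodup (chain_nodup b)]
  exact Finset.card_le_card fun a ha => h a (List.mem_toFinset.1 ha)

theorem IsGraph.mem_of_preceq {B : Finset Block} (hB : IsGraph B) {a b : Block}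
    (h : Preceq a b) (hb : b ∈ B) : a ∈ B := by
  rcases h.mem_past with rfl | h
  · exact hb
  · exact hB.2 b hb h

theorem isGraph_past {x : Block} (h : x ≠ genesis) : IsGraph x.past := by
  obtain ⟨p, hp⟩ := exists_parent h
  refine ⟨?_, fun b hb => past_subset_of_mem hb⟩
  rcases (genesis_preceq p).mem_past with e | h'
  · exact e ▸ parent_mem_past hp
  · exact past_subset_of_mem (parent_mem_past hp) h'

theorem IsGraph.insert_block {B : Finset Block} (hB : IsGraph B) {x : Block} (hx : x.past ⊆ B) :
    IsGraph (insert x B) := by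
  refine ⟨Finset.mem_insert_of_mem hB.1, fun b hb => ?_⟩
  rcases Finset.mem_insert.1 hb with rfl | hb
  · exact hx.trans (Finset.subset_insert _ _)
  · exact (hB.2 b hb).trans (Finset.subset_insert _ _)

/-! ### The successor in a chain -/

/-- The chain of `b` is a prefix of that of `t`, so `next` reads the head of the remaining suffix.
-/
theorem exists_chain_append {b t : Block} (hb : Preceq b t) :
    ∃ l, t.chain = b.chain ++ l ∧
      ∀ c, l.head? = some c ↔ c.parent = some b ∧ Preceq c t := by
  by_cases e : b = t
  · subst e
    refine ⟨[], by simp, fun c => ?_⟩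
    simp only [List.head?_nil, reduceCtorEq, false_iff, not_and]
    exact fun h => not_preceq_parent h
  induction t using parent_induction with
  | genesis => exact absurd (preceq_genesis_iff.1 hb) e
  | step t p h ih =>
    have hbp := ((preceq_iff_of_parent h).1 hb).resolve_right e
    by_cases e' : b = p
    · subst e'
      refine ⟨[t], chain_of_parent h, fun c => ?_⟩
      simp only [List.head?_cons, Option.some.injEq]
      constructor
      · rintro rfl; exact ⟨h, Preceq.refl _⟩
      · rintro ⟨hc, hct⟩
        exact eq_of_preceq_of_parent (Preceq.refl _) hct h hc
    · obtain ⟨l, hl, hc⟩ := ih hbp e'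
      refine ⟨l ++ [t], by rw [chain_of_parent h, hl, List.append_assoc], fun c => ?_⟩
      obtain ⟨c', hc', hc'p⟩ := exists_child_of_preceq hbp e'
      have hl' : l.head? = some c' := (hc c').2 ⟨hc', hc'p⟩
      rw [List.head?_append, hl', Option.some_or, ← hl', hc c, preceq_iff_of_parent h]
      refine and_congr_right fun hcb => ⟨.inl, ?_⟩
      rintro (h' | rfl)
      · exact h'
      · rw [h, Option.some.injEq] at hcb
        exact absurd hcb.symm e'

theorem idxOf_self_chain (b : Block) : b.chain.idxOf b + 1 = b.chain.length := by
  rcases chain_eq b with ⟨rfl, h'⟩ | ⟨q, hq, h'⟩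
  · rw [h']; simp
  · rw [h', List.idxOf_append_of_notMem (not_preceq_parent hq)]; simp

theorem next_chain_eq_some {t b c : Block} (hb : Preceq b t) :
    next t.chain b = some c ↔ c.parent = some b ∧ Preceq c t := by
  obtain ⟨l, hl, hc⟩ := exists_chain_append hb
  rw [← hc c, next, hl, List.idxOf_append_of_mem (Preceq.refl b), idxOf_self_chain,
    List.getElem?_append_right le_rfl, Nat.sub_self, List.head?_eq_getElem?]

theorem next_chain_eq_none {t b : Block} (hb : Preceq b t) :
    next t.chain b = none ↔ b = t := by
  constructor
  · intro h
    by_contra e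
    obtain ⟨c, hc⟩ := exists_child_of_preceq hb e
    rw [(next_chain_eq_some hb).2 hc] at h
    cases h
  · rintro rfl
    by_contra h
    obtain ⟨c, hc⟩ := Option.ne_none_iff_exists'.1 h
    have := (next_chain_eq_some hb).1 hc
    exact not_preceq_parent this.1 this.2

/-! ### Greedy paths -/

/-- The path repeats its starting block; dropping it lets the path be glued to `b.chain` in the
induction. -/
theorem visit_eq_chain {nx : Block → Option Block}
    (hnx : ∀ b c, nx b = some c → c.parent = some b) (n : ℕ) (b : Block) :
    ∃ t : Block, b.chain ++ (visit nx n b).tail = t.chain ∧ ∃ l, visit nx n b = b :: l := by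
  induction n generalizing b with
  | zero => exact ⟨b, by simp [visit], [], rfl⟩
  | succ n ih =>
    rw [visit]
    cases h : nx b with
    | none => exact ⟨b, by simp, [], rfl⟩
    | some c =>
      obtain ⟨t, ht, l, hl⟩ := ih c
      refine ⟨t, ?_, _, rfl⟩
      rw [← ht, chain_of_parent (hnx b c h)]
      simp [hl]

theorem visit_genesis_eq_chain {nx : Block → Option Block}
    (hnx : ∀ b c, nx b = some c → c.parent = some b) (n : ℕ) :
    ∃ t : Block, visit nx n genesis = t.chain := by
  obtain ⟨t, ht, l, hl⟩ := visit_eq_chain hnx n genesis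
  refine ⟨t, ?_⟩
  rw [← ht, hl]; simp [chain]

/-- A chain contains one child of each block, so a member of a greedy path determines all choices
made on the way to it. With the converse `mem_visit`, paths become conditions on single parent
links. -/
theorem nx_of_mem_visit {nx : Block → Option Block}
    (hnx : ∀ b c, nx b = some c → c.parent = some b) {n : ℕ} {b x : Block}
    (hx : x ∈ visit nx n b) :
    Preceq b x ∧ ∀ a p, Preceq a x → a.parent = some p → Preceq b p → nx p = some a := by
  have base : ∀ b : Block, Preceq b b ∧
      ∀ a p, Preceq a b → a.parent = some p → Preceq b p → nx p = some a := fun b =>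
    ⟨Preceq.refl _, fun a p ha hp hbp =>
      absurd (ha.trans hbp) (not_preceq_parent hp)⟩
  induction n generalizing b with
  | zero =>
    simp only [visit, List.mem_singleton] at hx
    subst hx; exact base x
  | succ n ih =>
    rw [visit] at hx
    cases h : nx b with
    | none =>
      simp only [h, List.mem_singleton] at hx
      subst hx; exact base x
    | some c =>
      simp only [h, List.mem_cons] at hx
      rcases hx with rfl | hx
      · exact base x
      · obtain ⟨hcx, hall⟩ := ih hx
        have hc := hnx b c h
        refine ⟨hcx.parent hc, fun a p ha hp hbp => ?_⟩
        by_cases e : b = p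
        · subst e
          rw [h, eq_of_preceq_of_parent hcx ha hc hp]
        · obtain ⟨c', hc', hc'p⟩ := exists_child_of_preceq hbp e
          have : c = c' := eq_of_preceq_of_parent hcx
            (hc'p.trans (Preceq.parent hp ha)) hc hc'
          subst this
          exact hall a p ha hp hc'p

theorem mem_visit {nx : Block → Option Block} {n : ℕ} {b x : Block} (hbx : Preceq b x)
    (h : ∀ a p, Preceq a x → a.parent = some p → Preceq b p → nx p = some a)
    (hn : x.chain.length ≤ b.chain.length + n) : x ∈ visit nx n b := by
  have mem_self : ∀ n b, b ∈ visit nx n b := by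
    intro n b
    cases n with
    | zero => simp [visit]
    | succ n => rw [visit]; cases nx b <;> simp
  by_cases e : b = x
  · subst e; exact mem_self _ _
  · induction n generalizing b with
    | zero =>
      obtain ⟨c, hc, hcx⟩ := exists_child_of_preceq hbx e
      obtain ⟨l, hl, -⟩ := exists_chain_append hcx
      rw [hl, chain_of_parent hc] at hn
      simp at hn
    | succ n ih =>
      obtain ⟨c, hc, hcx⟩ := exists_child_of_preceq hbx e
      rw [visit, h c b hcx hc (Preceq.refl _)]
      refine List.mem_cons_of_mem _ ?_
      by_cases e' : c = x
      · subst e'; exact mem_self _ _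
      · refine ih hcx (fun a p ha hp hcp => h a p ha hp (Preceq.trans ?_ hcp)) ?_ e'
        · exact (Preceq.refl c).parent hc
        · rw [chain_of_parent hc]
          simp only [List.length_append, List.length_singleton]
          omega

/-- The budget `B.card` never stops the path early: a chain has no repetitions, and all its blocks
lie in `B`. -/
theorem mem_visit_genesis_iff {nx : Block → Option Block}
    (hnx : ∀ b c, nx b = some c → c.parent = some b) {B : Finset Block} (hB : genesis ∈ B)
    (hnB : ∀ b c, nx b = some c → c ∈ B) {x : Block} :
    x ∈ visit nx B.card genesis ↔
      ∀ a p, Preceq a x → a.parent = some p → nx p = some a := by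
  constructor
  · exact fun hx a p ha hp => (nx_of_mem_visit hnx hx).2 a p ha hp (genesis_preceq p)
  · intro h
    refine mem_visit (genesis_preceq x) (fun a p ha hp _ => h a p ha hp) ?_
    refine (chain_length_le_card fun a ha => ?_).trans (Nat.le_add_left _ _)
    by_cases e : a = genesis
    · exact e ▸ hB
    · obtain ⟨p, hp⟩ := exists_parent e
      exact hnB p a (h a p ha hp)

/-- A nonempty prefix of a chain is the chain of its last block; `hP` excludes the empty prefix,
which is no block's chain. -/
theorem takeWhile_chain (P : Block → Bool) (hP : P genesis) (t : Block) :
    ∃ t', t.chain.takeWhile P = t'.chain ∧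
      ∀ x, Preceq x t' ↔ Preceq x t ∧ ∀ a, Preceq a x → P a := by
  induction t using parent_induction with
  | genesis =>
    refine ⟨genesis, by simp [chain, hP], fun x => ?_⟩
    simp only [preceq_genesis_iff]
    constructor
    · rintro rfl
      exact ⟨rfl, fun a ha => preceq_genesis_iff.1 ha ▸ hP⟩
    · exact fun h => h.1
  | step t p h ih =>
    obtain ⟨t', ht', hx⟩ := ih
    by_cases hall : ∀ a, Preceq a t → P a
    · refine ⟨t, ?_, fun x => ?_⟩
      · rw [List.takeWhile_eq_self_iff]
        exact hall
      · exact ⟨fun hxt => ⟨hxt, fun a ha => hall a (ha.trans hxt)⟩, fun h => h.1⟩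
    · refine ⟨t', ?_, fun x => ?_⟩
      · rw [← ht', chain_of_parent h, List.takeWhile_append]
        split_ifs with hlen
        · have hp : ∀ a ∈ p.chain, P a := by
            rw [← List.takeWhile_eq_self_iff]
            exact (List.takeWhile_prefix _).eq_of_length hlen
          have : ¬ P t := fun hPt => hall fun a ha => by
            rcases (preceq_iff_of_parent h).1 ha with ha | rfl
            · exact hp a ha
            · exact hPt
          simp [this, List.takeWhile_eq_self_iff.2 hp]
        · rfl
      · rw [hx x, preceq_iff_of_parent h]
        refine ⟨fun ⟨h1, h2⟩ => ⟨.inl h1, h2⟩, ?_⟩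
        rintro ⟨h1 | rfl, h2⟩
        · exact ⟨h1, h2⟩
        · exact absurd h2 hall

/-! ## Subtree weights -/

section weights

variable {w : Block → ℝ} {B B' : Finset Block} {b c x : Block}

theorem mem_subT : x ∈ subT B b ↔ x ∈ B ∧ Preceq b x := Finset.mem_filter

theorem subT_subset_subT (hB : B ⊆ B') (h : Preceq c b) : subT B b ⊆ subT B' c := fun x hx => by
  rw [mem_subT] at hx ⊢
  exact ⟨hB hx.1, h.trans hx.2⟩

theorem totalW_nonneg (hw : ∀ x, 0 ≤ w x) : 0 ≤ totalW w B := Finset.sum_nonneg fun x _ => hw x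

theorem totalW_mono (hw : ∀ x, 0 ≤ w x) (h : B ⊆ B') : totalW w B ≤ totalW w B' :=
  Finset.sum_le_sum_of_subset_of_nonneg h fun x _ _ => hw x

theorem totalW_union_le (hw : ∀ x, 0 ≤ w x) : totalW w (B ∪ B') ≤ totalW w B + totalW w B' := by
  rw [totalW, totalW, totalW, ← Finset.sum_union_inter]
  exact le_add_of_nonneg_right (Finset.sum_nonneg fun x _ => hw x)

theorem totalW_insert_le (hw : ∀ x, 0 ≤ w x) : totalW w (insert x B) ≤ totalW w B + w x := by
  rw [Finset.insert_eq, add_comm]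
  simpa [totalW] using totalW_union_le (w := w) (B := {x}) (B' := B) hw

theorem totalW_union_of_disjoint (h : Disjoint B B') :
    totalW w (B ∪ B') = totalW w B + totalW w B' := Finset.sum_union h

theorem subTW_nonneg (hw : ∀ x, 0 ≤ w x) : 0 ≤ subTW w B b := totalW_nonneg hw

theorem subTW_mono (hw : ∀ x, 0 ≤ w x) (hB : B ⊆ B') (h : Preceq c b) :
    subTW w B b ≤ subTW w B' c := totalW_mono hw (subT_subset_subT hB h)

theorem subTW_mono_left (hw : ∀ x, 0 ≤ w x) (hB : B ⊆ B') : subTW w B b ≤ subTW w B' b :=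
  subTW_mono hw hB (Preceq.refl b)

theorem subT_insert_of_preceq (h : Preceq b x) : subT (insert x B) b = insert x (subT B b) := by
  rw [subT, Finset.filter_insert, if_pos h, subT]

theorem subT_insert_of_not_preceq (h : ¬ Preceq b x) : subT (insert x B) b = subT B b := by
  rw [subT, Finset.filter_insert, if_neg h, subT]

theorem subTW_insert (h : Preceq b x) (hx : x ∉ B) :
    subTW w (insert x B) b = subTW w B b + w x := by
  rw [subTW, subT_insert_of_preceq h, totalW, Finset.sum_insert, add_comm]
  · rfl
  · exact fun h' => hx (mem_subT.1 h').1

theorem subTW_insert_of_not_preceq (h : ¬ Preceq b x) :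
    subTW w (insert x B) b = subTW w B b := by
  rw [subTW, subT_insert_of_not_preceq h, subTW]

theorem subTW_insert_le (hw : ∀ x, 0 ≤ w x) :
    subTW w (insert x B) b ≤ subTW w B b + w x := by
  by_cases h : Preceq b x
  · rw [subTW, subT_insert_of_preceq h]
    exact totalW_insert_le hw
  · rw [subTW_insert_of_not_preceq h]
    exact le_add_of_nonneg_right (hw x)

theorem subTW_union_of_disjoint (h : Disjoint B B') :
    subTW w (B ∪ B') b = subTW w B b + subTW w B' b := by
  rw [subTW, subT, Finset.filter_union, totalW_union_of_disjoint]
  · rfl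
  · exact Finset.disjoint_filter_filter h

theorem subTW_sdiff_add (h : B ⊆ B') : subTW w (B' \ B) b + subTW w B b = subTW w B' b := by
  rw [← subTW_union_of_disjoint Finset.sdiff_disjoint, Finset.sdiff_union_of_subset h]

/-- A graph contains the ancestors of its members, so a block outside it has no descendant inside.
-/
theorem IsGraph.subTW_eq_zero (hB : IsGraph B) (hb : b ∉ B) : subTW w B b = 0 := by
  have : subT B b = ∅ := Finset.eq_empty_of_forall_notMem fun x hx =>
    hb (hB.mem_of_preceq (mem_subT.1 hx).2 (mem_subT.1 hx).1)
  rw [subTW, this, totalW, Finset.sum_empty]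

theorem exists_of_subTW_pos (h : 0 < subTW w B b) : ∃ x ∈ B, Preceq b x := by
  by_contra hcon
  push Not at hcon
  have : subT B b = ∅ := Finset.eq_empty_of_forall_notMem fun x hx =>
    hcon x (mem_subT.1 hx).1 (mem_subT.1 hx).2
  rw [subTW, this, totalW, Finset.sum_empty] at h
  exact h.false

theorem IsGraph.mem_of_subTW_pos (hB : IsGraph B) (hsub : B' ⊆ B) (h : 0 < subTW w B' b) :
    b ∈ B := by
  obtain ⟨x, hx, hbx⟩ := exists_of_subTW_pos h
  exact hB.mem_of_preceq hbx (hsub hx)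

theorem mem_chldn {p : Option Block} : x ∈ chldn w B p ↔ x ∈ B ∧ x.parent = p ∧ 0 < w x :=
  Finset.mem_filter

theorem sibSubTW_le {K : ℝ} (hK : 0 ≤ K)
    (h : ∀ c ∈ B, c.parent = b.parent → 0 < w c → c ≠ b → subTW w B c ≤ K) :
    sibSubTW w B b ≤ K := by
  rw [sibSubTW]
  split_ifs with hne
  · refine Finset.sup'_le _ _ fun c hc => ?_
    rw [Finset.mem_erase, mem_chldn] at hc
    exact h c hc.2.1 hc.2.2.1 hc.2.2.2 hc.1
  · exact hK

theorem sibSubTW_nonneg (hw : ∀ x, 0 ≤ w x) : 0 ≤ sibSubTW w B b := by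
  rw [sibSubTW]
  split_ifs with hne
  · obtain ⟨c, hc⟩ := hne
    exact (subTW_nonneg hw).trans (Finset.le_sup' (subTW w B) hc)
  · exact le_rfl

theorem subTW_le_sibSubTW_of_mem (hc : c ∈ B) (hp : c.parent = b.parent) (hwc : 0 < w c)
    (hne : c ≠ b) : subTW w B c ≤ sibSubTW w B b := by
  have hmem : c ∈ (chldn w B b.parent).erase b :=
    Finset.mem_erase.2 ⟨hne, mem_chldn.2 ⟨hc, hp, hwc⟩⟩
  rw [sibSubTW, dif_pos ⟨c, hmem⟩]
  exact Finset.le_sup' (subTW w B) hmem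

/-- For `c` outside the graph the left side is 0, so membership need not be assumed. -/
theorem IsGraph.subTW_le_sibSubTW (hB : IsGraph B) (hw : ∀ x, 0 ≤ w x)
    (hp : c.parent = b.parent) (hwc : 0 < w c) (hne : c ≠ b) :
    subTW w B c ≤ sibSubTW w B b := by
  by_cases hc : c ∈ B
  · exact subTW_le_sibSubTW_of_mem hc hp hwc hne
  · rw [hB.subTW_eq_zero hc]
    exact sibSubTW_nonneg hw

theorem sibSubTW_mono (hw : ∀ x, 0 ≤ w x) (h : B ⊆ B') : sibSubTW w B b ≤ sibSubTW w B' b :=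
  sibSubTW_le (sibSubTW_nonneg hw) fun _ hc hp hwc hne =>
    (subTW_mono_left hw h).trans (subTW_le_sibSubTW_of_mem (h hc) hp hwc hne)

/-- The inserted block may itself be a new sibling; in a graph its subtree had weight 0 before. -/
theorem IsGraph.sibSubTW_insert_le (hB : IsGraph B) (hw : ∀ x, 0 ≤ w x) :
    sibSubTW w (insert x B) b ≤ sibSubTW w B b + w x :=
  sibSubTW_le (add_nonneg (sibSubTW_nonneg hw) (hw x)) fun _ _ hp hwc hne =>
    (subTW_insert_le hw).trans
      (add_le_add_left (hB.subTW_le_sibSubTW hw hp hwc hne) _)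

/-- A block that is not below a sibling of `b` does not affect the siblings of `b`. -/
theorem IsGraph.sibSubTW_insert (hB : IsGraph B) (hw : ∀ x, 0 ≤ w x)
    (h : ∀ c, c.parent = b.parent → c ≠ b → ¬ Preceq c x) :
    sibSubTW w (insert x B) b = sibSubTW w B b := by
  refine le_antisymm (sibSubTW_le (sibSubTW_nonneg hw) fun c _ hp hwc hne => ?_)
    (sibSubTW_mono hw (Finset.subset_insert _ _))
  rw [subTW_insert_of_not_preceq (h c hp hne)]
  exact hB.subTW_le_sibSubTW hw hp hwc hne

theorem IsGraph.sibSubTW_insert_of_preceq (hB : IsGraph B) (hw : ∀ x, 0 ≤ w x)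
    (hb : b ≠ genesis) (h : Preceq b x) : sibSubTW w (insert x B) b = sibSubTW w B b := by
  obtain ⟨p, hp⟩ := exists_parent hb
  refine hB.sibSubTW_insert hw fun c hc hne hcx => hne ?_
  exact eq_of_preceq_of_parent hcx h (hc.trans hp) hp

/-- Two nested graphs compare a block with its siblings in the same way, up to the weight of the
difference. -/
theorem sub_sibSubTW_le {L Pa U : Finset Block} {p : Block} (hPa : IsGraph Pa)
    (hw : ∀ x, 0 ≤ w x) (hL : L ⊆ Pa) (hU : Pa ⊆ U) (hc : c.parent = some p) :
    subTW w Pa c - sibSubTW w Pa c - subTW w (U \ L) p ≤ subTW w L c - sibSubTW w U c := by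
  have h1 : subTW w (Pa \ L) c + subTW w L c = subTW w Pa c := subTW_sdiff_add hL
  have hpre : ∀ d : Block, d.parent = some p → Preceq p d := fun d hd =>
    (preceq_iff_of_parent hd).2 (.inl (Preceq.refl p))
  have hdisj : Disjoint (Pa \ L) (U \ Pa) :=
    Finset.disjoint_left.2 fun y hy hy' =>
      (Finset.mem_sdiff.1 hy').2 (Finset.mem_sdiff.1 hy).1
  have hsub : (Pa \ L) ∪ (U \ Pa) ⊆ U \ L := by
    intro y hy
    rw [Finset.mem_union, Finset.mem_sdiff, Finset.mem_sdiff] at hy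
    rw [Finset.mem_sdiff]
    rcases hy with hy | hy
    · exact ⟨hU hy.1, hy.2⟩
    · exact ⟨hy.1, fun h => hy.2 (hL h)⟩
  have h2 : sibSubTW w U c ≤ sibSubTW w Pa c + subTW w (U \ L) p - subTW w (Pa \ L) c := by
    -- What `L` misses below `c` and what `U` adds below `d` are disjoint parts of `U \ L` under
    -- `p`, so their sum is charged only once.
    have key : ∀ d : Block, d.parent = some p →
        subTW w (Pa \ L) c + subTW w (U \ Pa) d ≤ subTW w (U \ L) p := by
      intro d hd
      calc subTW w (Pa \ L) c + subTW w (U \ Pa) d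
          ≤ subTW w (Pa \ L) p + subTW w (U \ Pa) p :=
            add_le_add (subTW_mono hw le_rfl (hpre c hc)) (subTW_mono hw le_rfl (hpre d hd))
        _ = subTW w ((Pa \ L) ∪ (U \ Pa)) p := (subTW_union_of_disjoint hdisj).symm
        _ ≤ subTW w (U \ L) p := subTW_mono_left hw hsub
    refine sibSubTW_le ?_ fun d hd hp hwd hne => ?_
    · have := key c hc
      have h0 : 0 ≤ subTW w (U \ Pa) c := subTW_nonneg hw
      have h0' : 0 ≤ sibSubTW w Pa c := sibSubTW_nonneg hw
      linarith
    · have := key d (hp.trans hc)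
      have h3 : subTW w (U \ Pa) d + subTW w Pa d = subTW w U d := subTW_sdiff_add hU
      have h4 := hPa.subTW_le_sibSubTW hw hp hwd hne
      linarith
  linarith

end weights

/-! ### Block weights -/

namespace Params

variable {π : Params}

theorem weight_cases (π : Params) (b : Block) :
    π.weight b = 0 ∨ π.weight b = 1 ∨ π.weight b = π.ηw := by
  rw [weight_eq, weightIf]
  split_ifs <;> simp

theorem weight_nonneg (hw : 0 < π.ηw) (b : Block) : 0 ≤ π.weight b := by
  rcases π.weight_cases b with h | h | h <;> rw [h]
  · exact zero_le_one
  · exact hw.le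

/-- Weight 1 reveals the optimistic strategy only if heavy blocks have another weight; hence the
condition `ηw ≠ 1` carried by the flag invariant. -/
theorem not_adaptCon_of_weight_eq_one {b : Block} (h : π.weight b = 1) (h1 : π.ηw ≠ 1) :
    ¬ π.AdaptCon π.weight b.past := by
  intro hcon
  rw [weight_eq, weightIf, if_neg (not_not.2 hcon)] at h
  split_ifs at h
  · exact h1 h
  · exact zero_ne_one h

/-! ## Age -/

theorem timerHeight_eq (π : Params) (b : Block) : π.timerHeight b = π.maxTH b.past + 1 := by
  rw [timerHeight, maxTH,
    Finset.sup_attach b.past fun x => if π.IsTimer x then π.timerHeight x else 0,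
    Finset.sup_ite]
  simp

theorem maxTH_mono {B B' : Finset Block} (h : B ⊆ B') : π.maxTH B ≤ π.maxTH B' :=
  Finset.sup_mono (Finset.filter_subset_filter _ h)

theorem timerHeight_le_of_preceq {a b : Block} (h : Preceq a b) :
    π.timerHeight a ≤ π.timerHeight b := by
  rcases h.mem_past with rfl | h
  · exact le_rfl
  · rw [timerHeight_eq, timerHeight_eq]
    exact Nat.succ_le_succ (maxTH_mono (past_subset_of_mem h))

theorem Old.mono {B B' : Finset Block} {a b : Block} (h : π.Old B b) (hB : B ⊆ B')
    (hab : Preceq a b) : π.Old B' a := by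
  have h1 := maxTH_mono (π := π) hB
  have h2 := timerHeight_le_of_preceq (π := π) hab
  unfold Old at h ⊢
  omega

/-- The timer height of `b` exceeds that of every timer block in its past, so the age is negative,
while `ηb` is a natural number. -/
theorem not_old_of_subset_past {B : Finset Block} {b : Block} (h : B ⊆ b.past) :
    ¬ π.Old B b := by
  have h1 := maxTH_mono (π := π) h
  have h2 := timerHeight_eq π b
  unfold Old
  omega

/-! ## The pivot chain -/

section pivot

variable {w : Block → ℝ} {B : Finset Block} {b c : Block}

theorem bestChild_eq_some (h : π.bestChild w B b = some c) :
    c ∈ chldn w B (some b) ∧ ∀ c' ∈ chldn w B (some b), subTW w B c' ≤ subTW w B c := by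
  rw [bestChild] at h
  split_ifs at h with hex
  rw [Option.some.injEq] at h
  have := hex.choose_spec
  rw [h] at this
  exact ⟨this.1, fun c' hc' => (this.2 c' hc').elim le_of_lt fun h => h.1.le⟩

theorem bestChild_eq_some_of_lt (hc : c ∈ chldn w B (some b))
    (h : ∀ c' ∈ chldn w B (some b), c' ≠ c → subTW w B c' < subTW w B c) :
    π.bestChild w B b = some c := by
  have hex : ∃ c ∈ chldn w B (some b), ∀ c' ∈ chldn w B (some b),
      subTW w B c' < subTW w B c ∨
        (subTW w B c' = subTW w B c ∧ π.digest c ≤ π.digest c') := by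
    refine ⟨c, hc, fun c' hc' => ?_⟩
    by_cases e : c' = c
    · exact .inr ⟨by rw [e], by rw [e]⟩
    · exact .inl (h c' hc' e)
  rw [bestChild, dif_pos hex, Option.some.injEq]
  have hspec := hex.choose_spec
  by_contra hne
  have h1 := h _ hspec.1 hne
  rcases hspec.2 c hc with h2 | h2
  · exact (h1.trans h2).false
  · exact (h1.trans_eq h2.1).false

theorem bestChild_eq_none (h : π.bestChild w B b = none) : chldn w B (some b) = ∅ := by
  by_contra hne
  -- The lexicographic order on weight and reversed digest encodes the tie-breaking rule, so a
  -- nonempty finite set of children has a best one.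
  obtain ⟨c, hc, hmax⟩ := Finset.exists_max_image (chldn w B (some b))
    (fun c => toLex (subTW w B c, OrderDual.toDual (π.digest c)))
    (Finset.nonempty_iff_ne_empty.2 hne)
  have hex : ∃ c ∈ chldn w B (some b), ∀ c' ∈ chldn w B (some b),
      subTW w B c' < subTW w B c ∨
        (subTW w B c' = subTW w B c ∧ π.digest c ≤ π.digest c') := by
    refine ⟨c, hc, fun c' hc' => ?_⟩
    exact Prod.Lex.toLex_le_toLex.1 (hmax c' hc')
  rw [bestChild, dif_pos hex] at h
  cases h

theorem bestChild_parent (b c : Block) (h : π.bestChild w B b = some c) : c.parent = some b :=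
  (mem_chldn.1 (bestChild_eq_some h).1).2.1

theorem bestChild_mem (b c : Block) (h : π.bestChild w B b = some c) : c ∈ B :=
  (mem_chldn.1 (bestChild_eq_some h).1).1

variable {x p : Block}

theorem Valid.mem_pivot_iff (hx : π.Valid x) (hp : x.parent = some p) {a : Block} :
    a ∈ π.pivot π.weight x.past ↔ Preceq a p := by
  have h := hx.2.2
  rw [chain_of_parent hp] at h
  rw [List.append_cancel_right h, Preceq]

/-- Validity equates the chain of the parent with a greedy path, so membership reduces to one
best-child condition per parent link. -/
theorem Valid.preceq_iff (hx : π.Valid x) (hp : x.parent = some p) {a : Block} :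
    Preceq a p ↔
      ∀ d q, Preceq d a → d.parent = some q → π.bestChild π.weight x.past q = some d := by
  rw [← hx.mem_pivot_iff hp, pivot,
    mem_visit_genesis_iff bestChild_parent (isGraph_past hx.1).1 bestChild_mem]

theorem Valid.bestChild_eq (hx : π.Valid x) (hp : x.parent = some p) {a : Block}
    (hc : Preceq c p) (hca : c.parent = some a) :
    π.bestChild π.weight x.past a = some c :=
  (hx.preceq_iff hp).1 hc c a (Preceq.refl c) hca

theorem Valid.preceq_of_bestChild (hx : π.Valid x) (hp : x.parent = some p) {a : Block}
    (ha : Preceq a p) (hc : π.bestChild π.weight x.past a = some c) : Preceq c p := by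
  refine (hx.preceq_iff hp).2 fun d q hd hq => ?_
  have hca := bestChild_parent a c hc
  rcases (preceq_iff_of_parent hca).1 hd with hd' | rfl
  · exact hx.bestChild_eq hp (hd'.trans ha) hq
  · rw [hca, Option.some.injEq] at hq
    exact hq ▸ hc

/-- A best child of `p` would continue the pivot chain beyond its last block `p`. -/
theorem Valid.chldn_parent_eq_empty (hx : π.Valid x) (hp : x.parent = some p) :
    chldn π.weight x.past (some p) = ∅ := by
  refine bestChild_eq_none (π := π) ?_
  by_contra h
  obtain ⟨c, hc⟩ := Option.ne_none_iff_exists'.1 h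
  exact not_preceq_parent (bestChild_parent p c hc)
    (hx.preceq_of_bestChild hp (Preceq.refl p) hc)

/-- On its own chain, a valid block sees no sibling that is heavier. -/
theorem Valid.sibSubTW_le_subTW (hw : 0 < π.ηw) (hx : π.Valid x) (hc : Preceq c x)
    (hcb : c.parent = some b) :
    sibSubTW π.weight x.past c ≤ subTW π.weight x.past c := by
  obtain ⟨p, hp⟩ := exists_parent hx.1
  refine sibSubTW_le (subTW_nonneg (weight_nonneg hw)) fun d hd hdp hwd _ => ?_
  rcases (preceq_iff_of_parent hp).1 hc with hc | rfl
  · exact (bestChild_eq_some (hx.bestChild_eq hp hc hcb)).2 d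
      (mem_chldn.2 ⟨hd, hdp.trans hcb, hwd⟩)
  -- The last link of the chain, from `p` to the block itself, is not on the pivot chain; there the
  -- block has no competitor.
  · have : d ∈ chldn π.weight c.past (some p) := mem_chldn.2 ⟨hd, hdp.trans hp, hwd⟩
    rw [hx.chldn_parent_eq_empty hp] at this
    exact absurd this (Finset.notMem_empty d)

/-- A valid block whose past graph lies between `L` and `U` follows the children that dominate
for `L` and `U`. -/
theorem Valid.preceq_of_dominant (hw : 0 < π.ηw) (hx : π.Valid x) {L U : Finset Block}
    (hL : L ⊆ x.past) (hU : x.past ⊆ U) (hb : Preceq b x) (hbx : b ≠ x)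
    (hcb : c.parent = some b) (hwc : 0 < π.weight c)
    (hc : sibSubTW π.weight U c < subTW π.weight L c) : Preceq c x := by
  obtain ⟨p, hp⟩ := exists_parent hx.1
  have hbp := ((preceq_iff_of_parent hp).1 hb).resolve_right hbx
  have hw' := weight_nonneg hw
  have hpos : 0 < subTW π.weight L c := (sibSubTW_nonneg hw').trans_lt hc
  have hcm := (isGraph_past hx.1).mem_of_subTW_pos hL hpos
  refine (preceq_iff_of_parent hp).2 (.inl (hx.preceq_of_bestChild hp hbp
    (bestChild_eq_some_of_lt (mem_chldn.2 ⟨hcm, hcb, hwc⟩) fun d hd hne => ?_)))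
  rw [mem_chldn] at hd
  -- A sibling `d` loses even when it is given all of `U` and `c` only `L`.
  calc subTW π.weight x.past d ≤ subTW π.weight U d := subTW_mono_left hw' hU
    _ ≤ sibSubTW π.weight U c :=
      subTW_le_sibSubTW_of_mem (hU hd.1) (hd.2.1.trans hcb.symm) hd.2.2 hne
    _ < subTW π.weight L c := hc
    _ ≤ subTW π.weight x.past c := subTW_mono_left hw' hL

/-- Under the optimistic strategy, a valid block extends every old block of its pivot chain by a
child that dominates its siblings by `ηa`. -/
theorem Valid.exists_dominant_child (hx : π.Valid x)
    (hopt : ¬ π.AdaptCon π.weight x.past) (hb : Preceq b x) (hbx : b ≠ x)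
    (hold : π.Old x.past b) :
    ∃ c, c.parent = some b ∧ Preceq c x ∧ c ∈ x.past ∧ 0 < π.weight c ∧
      π.ηa ≤ subTW π.weight x.past c - sibSubTW π.weight x.past c := by
  obtain ⟨p, hp⟩ := exists_parent hx.1
  have hbp := ((preceq_iff_of_parent hp).1 hb).resolve_right hbx
  have hpiv : π.pivot π.weight x.past = p.chain := by
    have h := hx.2.2
    rw [chain_of_parent hp] at h
    exact List.append_cancel_right h
  rw [AdaptCon, not_and] at hopt
  have hopt := hopt ⟨p, parent_mem_past hp⟩
  rw [not_or, hpiv, tip_chain] at hopt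
  -- The second clause of `AdaptCon` forbids an old pivot tip, so an old `b` has a successor on the
  -- pivot chain.
  have hne : b ≠ p := fun e => hopt.2 (e ▸ hold)
  obtain ⟨c, hcb, hcp⟩ := exists_child_of_preceq hbp hne
  have hmem := mem_chldn.1 (bestChild_eq_some (hx.bestChild_eq hp hcp hcb)).1
  refine ⟨c, hcb, (preceq_iff_of_parent hp).2 (.inl hcp), hmem.1, hmem.2.2, ?_⟩
  by_contra hlt
  exact hopt.1 ⟨c, hcp, b, hcb, hold, not_le.1 hlt⟩

end pivot

end Params

theorem EventType.eq_or (t : EventType) :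
    t = .hGenRls ∨ t = .mGen ∨ t = .mRls ∨ t = .arvl := by
  cases t <;> simp

namespace Params

variable {π : Params}

/-! ## The chain of the adversary state -/

/-- A released block of positive weight with positive `Adv`. -/
def Dominant (π : Params) (max min : Finset Block) (f : Option Block) (c : Block) : Prop :=
  c ∈ max ∧ 0 < π.weight c ∧ 0 < π.adv max min f c

section chain

variable {max min : Finset Block} {f : Option Block} {b c d : Block}

/-- Each of two distinct dominant siblings would outweigh, with its part in `min ∪ f` alone, the
other's subtree in the larger graph `max`. -/
theorem Dominant.eq_of_parent (hw : 0 < π.ηw) (hsub : min ∪ f.toFinset ⊆ max)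
    (hc : π.Dominant max min f c) (hd : π.Dominant max min f d)
    (hp : c.parent = d.parent) : c = d := by
  by_contra hne
  have hw' := weight_nonneg hw
  have h1 := subTW_le_sibSubTW_of_mem hc.1 hp hc.2.1 hne
  have h2 := subTW_le_sibSubTW_of_mem hd.1 hp.symm hd.2.1 (Ne.symm hne)
  have h3 : subTW π.weight _ c ≤ _ := subTW_mono_left hw' hsub
  have h4 : subTW π.weight _ d ≤ _ := subTW_mono_left hw' hsub
  have h5 := hc.2.2
  have h6 := hd.2.2
  unfold adv at h5 h6
  linarith

theorem advChild_eq_some_iff (hw : 0 < π.ηw) (hsub : min ∪ f.toFinset ⊆ max) :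
    π.advChild max min f b = some c ↔ c.parent = some b ∧ π.Dominant max min f c := by
  rw [advChild]
  split_ifs with h
  · have hspec := h.choose_spec
    rw [mem_chldn] at hspec
    have hdom : π.Dominant max min f h.choose := ⟨hspec.1.1, hspec.1.2.2, hspec.2⟩
    rw [Option.some.injEq]
    constructor
    · rintro rfl
      exact ⟨hspec.1.2.1, hdom⟩
    · rintro ⟨hp, hc⟩
      exact hdom.eq_of_parent hw hsub hc (hspec.1.2.1.trans hp.symm)
  · simp only [false_iff]
    rintro ⟨hp, hc⟩
    exact h ⟨c, mem_chldn.2 ⟨hc.1, hp, hc.2.1⟩, hc.2.2⟩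

/-- The new chain, described by its members. -/
theorem newChain_spec (hw : 0 < π.ηw) (hg : genesis ∈ max) (hsub : min ∪ f.toFinset ⊆ max)
    (C : List Block) :
    ∃ t : Block, π.newChain max min f C = t.chain ∧ ∀ b, Preceq b t ↔
      ∀ a, Preceq a b → a = genesis ∨ (π.Dominant max min f a ∧
        (Prec (tip C) a → (π.sm : ℝ) + π.sh < π.adv max min f a)) := by
  have hnx : ∀ b c, π.advChild max min f b = some c → c.parent = some b := fun b c h =>
    ((advChild_eq_some_iff hw hsub).1 h).1
  have hnB : ∀ b c, π.advChild max min f b = some c → c ∈ max := fun b c h =>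
    ((advChild_eq_some_iff hw hsub).1 h).2.1
  obtain ⟨u, hu⟩ := visit_genesis_eq_chain hnx max.card
  obtain ⟨t, ht, hmem⟩ := takeWhile_chain
    (fun b => decide ¬ (Prec (tip C) b ∧ π.adv max min f b ≤ π.sm + π.sh))
    (decide_eq_true fun h => h.1.2 (preceq_genesis_iff.1 h.1.1)) u
  refine ⟨t, by rw [newChain, hu, ht], fun b => ?_⟩
  have hbu : Preceq b u ↔
      ∀ a p, Preceq a b → a.parent = some p → π.advChild max min f p = some a := by
    rw [Preceq, ← hu]
    exact mem_visit_genesis_iff hnx hg hnB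
  rw [hmem, hbu]
  simp only [decide_eq_true_eq, not_and, not_le]
  constructor
  · rintro ⟨h1, h2⟩ a ha
    by_cases e : a = genesis
    · exact .inl e
    · obtain ⟨p, hp⟩ := exists_parent e
      exact .inr ⟨((advChild_eq_some_iff hw hsub).1 (h1 a p ha hp)).2, h2 a ha⟩
  · intro h
    refine ⟨fun a p ha hp => ?_, fun a ha hpre => ?_⟩
    · exact (advChild_eq_some_iff hw hsub).2
        ⟨hp, ((h a ha).resolve_left (ne_genesis_of_parent hp)).1⟩
    · rcases h a ha with rfl | h
      · exact absurd (preceq_genesis_iff.1 hpre.1) hpre.2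
      · exact h.2 hpre

end chain

/-! ## Invariants of the adversary state -/

/-- `Dominant` for the graphs of an adversary state. -/
abbrev Dom (π : Params) (s : AdvState) (c : Block) : Prop := π.Dominant s.max s.min s.f c

/-- `Adv` for the graphs of an adversary state. -/
noncomputable abbrev advOf (π : Params) (s : AdvState) (c : Block) : ℝ := π.adv s.max s.min s.f c

/-- The invariants of the graphs and of the flag block. -/
structure GraphInv (π : Params) (s : AdvState) : Prop where
  graph : IsGraph s.max
  min_sub : s.min ⊆ s.max
  flag : ∀ y, s.f = some y →
    y ∈ s.delta \ s.M ∧ π.weight y = π.ηw ∧ π.ηw ≠ 1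

/-- The invariants of the adversary state. -/
structure StateInv (π : Params) (s : AdvState) : Prop extends GraphInv π s where
  chain : s.C = (tip s.C).chain
  dom : ∀ b, Preceq b (tip s.C) → b = genesis ∨ π.Dom s b
  maximal : ∀ c, c.parent = some (tip s.C) → π.Dom s c → π.advOf s c ≤ π.sm + π.sh
  special : subT s.delta (tip s.C) ∩ s.M ⊆ s.S

/-- What the protocol guarantees about an event, in terms of the preceding adversary state. -/
structure Admissible (π : Params) (s : AdvState) (e : Event) : Prop where
  hGenRls : e.type = .hGenRls → π.Valid e.block ∧ e.block ∉ s.max ∧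
    e.block ∉ s.M ∧ s.min ⊆ e.block.past ∧ e.block.past ⊆ s.max
  mGen : e.type = .mGen → e.block ∉ s.max
  mRls : e.type = .mRls → e.block ∈ s.gen ∧ e.block ∈ s.M ∧ e.block ∉ s.max ∧
    e.block.past ⊆ s.max
  arvl : e.type = .arvl → e.block ∈ s.max

/-- `s'` carries the chain that the traverse function computes from the chain of `s`. -/
structure ChainStep (π : Params) (s s' : AdvState) : Prop where
  chain : s'.C = (tip s'.C).chain
  mem_iff : ∀ b, Preceq b (tip s'.C) ↔ ∀ a, Preceq a b → a = genesis ∨ (π.Dom s' a ∧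
    (Prec (tip s.C) a → (π.sm : ℝ) + π.sh < π.advOf s' a))
  S_eq : s'.S = s.S ∪ (subT s'.delta (tip s'.C) ∩ s'.M)
  v_eq : s'.v = s.v + Min.min (π.sm : ℝ) (totalW π.weight (s'.S \ s.S))

section invariants

variable {s s' : AdvState} {e : Event} {b c : Block}

theorem GraphInv.sub (h : π.GraphInv s) : s.min ∪ s.f.toFinset ⊆ s.max := by
  intro y hy
  rcases Finset.mem_union.1 hy with hy | hy
  · exact h.min_sub hy
  · have := (h.flag y (by simpa using hy)).1
    exact (Finset.mem_sdiff.1 (Finset.mem_sdiff.1 this).1).1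

theorem chainStep_ψ (hw : 0 < π.ηw) (h : π.GraphInv (π.ψ s e)) :
    π.ChainStep s (π.ψ s e) := by
  obtain ⟨t, ht, hmem⟩ := newChain_spec hw h.graph.1 h.sub s.C
  have hC : (π.ψ s e).C = t.chain := ht
  have htip : tip (π.ψ s e).C = t := by rw [hC, tip_chain]
  exact ⟨by rw [htip, hC], by rw [htip]; exact hmem, rfl, rfl⟩

theorem ChainStep.dom (h : π.ChainStep s s') (hb : Preceq b (tip s'.C)) (hg : b ≠ genesis) :
    π.Dom s' b :=
  (((h.mem_iff b).1 hb b (Preceq.refl b)).resolve_left hg).1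

theorem ChainStep.lt_adv (h : π.ChainStep s s') (hb : Preceq b (tip s'.C))
    (hp : Prec (tip s.C) b) : (π.sm : ℝ) + π.sh < π.advOf s' b := by
  refine (((h.mem_iff b).1 hb b (Preceq.refl b)).resolve_left ?_).2 hp
  rintro rfl
  exact hp.2 (preceq_genesis_iff.1 hp.1)

theorem ChainStep.extend (h : π.ChainStep s s') (hb : Preceq b (tip s'.C))
    (hcb : c.parent = some b) (hc : π.Dom s' c)
    (hlt : Prec (tip s.C) c → (π.sm : ℝ) + π.sh < π.advOf s' c) : Preceq c (tip s'.C) := by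
  refine (h.mem_iff c).2 fun a ha => ?_
  rcases (preceq_iff_of_parent hcb).1 ha with ha | rfl
  · exact (h.mem_iff b).1 hb a ha
  · exact .inr ⟨hc, hlt⟩

/-- Maximality is the trace of the cut-off rule: a dominant child of the tip is dropped only if its
`Adv` is at most `sm + sh`. -/
theorem ChainStep.stateInv (h : π.ChainStep s s') (hg : π.GraphInv s') : π.StateInv s' where
  toGraphInv := hg
  chain := h.chain
  dom b hb := ((h.mem_iff b).1 hb b (Preceq.refl b)).imp id And.left
  maximal c hc hdom := by
    by_contra hlt
    exact not_preceq_parent hc (h.extend (Preceq.refl _) hc hdom fun _ => not_le.1 hlt)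
  special := by rw [h.S_eq]; exact Finset.subset_union_right

/-- If `sm` or `sh` were 0, the corresponding clause of `Spe` would hold automatically. -/
theorem not_spe_pos (hw : 0 < π.ηw) (h : ¬ π.Spe s) : 0 < π.sm ∧ 0 < π.sh := by
  rw [Spe, not_or, not_or, not_le, not_le, not_le] at h
  refine ⟨?_, (Nat.zero_le _).trans_lt h.2.1⟩
  have : (0 : ℝ) < π.sm := (subTW_nonneg (weight_nonneg hw)).trans_lt h.1
  exact_mod_cast this

theorem ne_one_of_not_spe (hw : 0 < π.ηw) (hs : 2 * (π.sh : ℝ) + 2 * π.sm ≤ π.ηw)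
    (h : ¬ π.Spe s) : π.ηw ≠ 1 := by
  obtain ⟨h1, h2⟩ := not_spe_pos hw h
  have h1' : (1 : ℝ) ≤ π.sm := by exact_mod_cast h1
  have h2' : (1 : ℝ) ≤ π.sh := by exact_mod_cast h2
  intro h3
  linarith

/-- Without the special status, little weight below the tip of the chain may be unknown. -/
theorem subTW_delta_lt (hw : 0 < π.ηw) (h : ¬ π.Spe s) :
    subTW π.weight s.delta (tip s.C) < π.sm + π.sh +
      ((s.delta \ s.M).filter fun b => π.weight b = π.ηw).card * π.ηw := by
  have hw' := weight_nonneg hw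
  rw [Spe, not_or, not_or, not_le, not_le, not_le] at h
  have hsplit : subTW π.weight s.delta (tip s.C) =
      subTW π.weight (s.delta ∩ s.M) (tip s.C) + subTW π.weight (s.delta \ s.M) (tip s.C) := by
    rw [← subTW_union_of_disjoint (Finset.disjoint_sdiff_inter _ _).symm, Finset.union_comm,
      Finset.sdiff_union_inter]
  -- Only an upper bound is needed: for `ηw = 1` the blocks of weight 1 occur in both counts.
  have hle : subTW π.weight (s.delta \ s.M) (tip s.C) ≤
      ((s.delta \ s.M).filter fun b => π.weight b = 1).card +
        ((s.delta \ s.M).filter fun b => π.weight b = π.ηw).card * π.ηw := by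
    refine (totalW_mono hw' (Finset.filter_subset _ _)).trans ?_
    rw [totalW, Finset.card_filter, Finset.card_filter, Nat.cast_sum, Nat.cast_sum,
      Finset.sum_mul, ← Finset.sum_add_distrib]
    refine Finset.sum_le_sum fun x _ => ?_
    rcases π.weight_cases x with h0 | h0 | h0 <;> rw [h0] <;> split_ifs <;>
      first | contradiction | (push_cast; linarith)
  have hsh : (((s.delta \ s.M).filter fun b => π.weight b = 1).card : ℝ) < π.sh := by
    exact_mod_cast h.2.1
  linarith [h.1]

theorem subTW_delta_lt_of_not_hasHeavy (hw : 0 < π.ηw) (h : ¬ π.Spe s) (hh : ¬ π.HasHeavy s) :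
    subTW π.weight s.delta (tip s.C) < π.sm + π.sh := by
  have h1 := subTW_delta_lt hw h
  rwa [Finset.filter_eq_empty_iff.2 fun x hx hx' => hh ⟨x, hx, hx'⟩, Finset.card_empty,
    Nat.cast_zero, zero_mul, add_zero] at h1

theorem subTW_delta_lt_two (hw : 0 < π.ηw) (h : ¬ π.Spe s) :
    subTW π.weight s.delta (tip s.C) < π.sm + π.sh + 2 * π.ηw := by
  refine (subTW_delta_lt hw h).trans_le (add_le_add_right ?_ _)
  rw [Spe, not_or, not_or, not_le, not_le, not_le] at h
  have : (((s.delta \ s.M).filter fun b => π.weight b = π.ηw).card : ℝ) ≤ 2 := by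
    exact_mod_cast Nat.le_of_lt_succ h.2.2
  exact mul_le_mul_of_nonneg_right this hw.le

theorem GraphInv.flag_eq_none (h : π.GraphInv s) (hh : ¬ π.HasHeavy s) : s.f = none := by
  by_contra hne
  obtain ⟨y, hy⟩ := Option.ne_none_iff_exists'.1 hne
  exact hh ⟨y, (h.flag y hy).1, (h.flag y hy).2.1⟩

theorem newFlag_eq_self (h : e.type = .mGen ∨ e.type = .mRls) : π.newFlag s e = s.f := by
  rcases h with h | h <;> simp [newFlag, h]

theorem newFlag_arvl (h : e.type = .arvl) :
    π.newFlag s e = if s.f = some e.block then none else s.f := by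
  simp [newFlag, h]

/-- The event makes its block the flag block. -/
def Flagging (π : Params) (s : AdvState) (e : Event) : Prop :=
  e.type = .hGenRls ∧ π.weight e.block = π.ηw ∧ ¬ π.Spe s ∧ ¬ π.HasHeavy s

theorem newFlag_of_flagging (h : π.Flagging s e) : π.newFlag s e = some e.block := by
  rw [newFlag, if_pos ⟨h.2.1, h.1, h.2.2⟩]

theorem newFlag_hGenRls (ht : e.type = .hGenRls) (h : ¬ π.Flagging s e) :
    π.newFlag s e = s.f ∧ (π.weight e.block = π.ηw → s.f = none) ∨
      π.newFlag s e = none ∧ π.weight e.block = π.ηw ∧ s.f ≠ none := by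
  have h1 : ¬ (π.weight e.block = π.ηw ∧ e.type = .hGenRls ∧ ¬ π.Spe s ∧ ¬ π.HasHeavy s) :=
    fun h' => h ⟨ht, h'.1, h'.2.2⟩
  rw [newFlag, if_neg h1]
  split_ifs with h2 h3
  · exact .inr ⟨rfl, h2.1, h2.2.2⟩
  · rw [ht] at h3; cases h3.2
  · exact .inl ⟨rfl, fun h' => by_contra fun hne => h2 ⟨h', ht, hne⟩⟩

theorem newFlag_cases (s : AdvState) (e : Event) : π.newFlag s e = s.f ∨
    π.newFlag s e = none ∨ (π.Flagging s e ∧ π.newFlag s e = some e.block) := by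
  by_cases hf : π.Flagging s e
  · exact .inr (.inr ⟨hf, newFlag_of_flagging hf⟩)
  · have h1 : ¬ (π.weight e.block = π.ηw ∧ e.type = .hGenRls ∧ ¬ π.Spe s ∧ ¬ π.HasHeavy s) :=
      fun h' => hf ⟨h'.2.1, h'.1, h'.2.2⟩
    rw [newFlag, if_neg h1]
    split_ifs <;> simp

theorem GraphInv.step (hw : 0 < π.ηw) (hs : 2 * (π.sh : ℝ) + 2 * π.sm ≤ π.ηw)
    (h : π.GraphInv s) (he : π.Admissible s e) : π.GraphInv (π.ψ s e) := by
  have hmax : IsGraph (π.ψ s e).max ∧ (π.ψ s e).min ⊆ (π.ψ s e).max := by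
    rcases e.type.eq_or with ht | ht | ht | ht <;> simp only [ψ, Event.IsRls, ht]
    · obtain ⟨-, -, -, -, h5⟩ := he.hGenRls ht
      simpa using ⟨h.graph.insert_block h5, h.min_sub.trans (Finset.subset_insert _ _)⟩
    · simpa using ⟨h.graph, h.min_sub⟩
    · obtain ⟨-, -, -, h5⟩ := he.mRls ht
      simpa using ⟨h.graph.insert_block h5, h.min_sub.trans (Finset.subset_insert _ _)⟩
    · simpa using ⟨h.graph, Finset.insert_subset (he.arvl ht) h.min_sub⟩
  refine ⟨hmax.1, hmax.2, fun y hy => ?_⟩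
  have hy' : π.newFlag s e = some y := hy
  rcases newFlag_cases (π := π) s e with hf | hf | ⟨hfl, hf⟩
  · have hsf := hf.symm.trans hy'
    obtain ⟨h1, h2, h3⟩ := h.flag y hsf
    refine ⟨?_, h2, h3⟩
    rw [AdvState.delta, Finset.mem_sdiff, Finset.mem_sdiff] at h1 ⊢
    obtain ⟨⟨h4, h5⟩, h6⟩ := h1
    rcases e.type.eq_or with ht | ht | ht | ht <;> simp only [ψ, Event.IsRls, ht]
    · simp [h4, h5, h6]
    -- The flag block is already released, so it cannot be the malicious block generated now.
    · have : y ≠ e.block := by rintro rfl; exact he.mGen ht h4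
      simp [h4, h5, h6, this]
    · simp [h4, h5, h6]
    -- The arrival of the flag block clears the flag, so a flag that survives is still outside
    -- `min`.
    · have : y ≠ e.block := by
        rintro rfl
        rw [newFlag_arvl ht, if_pos hsf] at hy'
        cases hy'
      simp [h4, h5, h6, this]
  · rw [hf] at hy'; cases hy'
  · rw [hf, Option.some.injEq] at hy'
    subst hy'
    obtain ⟨-, h2, h4, -, -⟩ := he.hGenRls hfl.1
    refine ⟨?_, hfl.2.1, ne_one_of_not_spe hw hs hfl.2.2.1⟩
    have : e.block ∉ s.min := fun h' => h2 (h.min_sub h')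
    rw [AdvState.delta, Finset.mem_sdiff, Finset.mem_sdiff]
    simp [ψ, Event.IsRls, hfl.1, h4, this]

end invariants

/-! ## The potential -/

/-- The block potential value, without its domain. -/
noncomputable def potential (π : Params) (s : AdvState) (b : Block) : ℝ :=
  π.Pwith s b + π.Padv s (next s.C b) + π.Psp s b

/-- The weight of the light honest blocks below `c` that may be unknown to some honest nodes. -/
noncomputable def lightW (π : Params) (s : AdvState) (c : Block) : ℝ :=
  totalW π.weight (subT s.delta c ∩ π.lightHonest s)

/-- The weight of the malicious blocks below `c` outside `T` that may be unknown to some honest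
nodes. -/
noncomputable def malW (π : Params) (s : AdvState) (T : Finset Block) (c : Block) : ℝ :=
  totalW π.weight ((subT s.delta c ∩ s.M) \ T)

section potential

variable {s s' : AdvState} {e : Event} {b c : Block} {δ : ℝ}

theorem P_eq_some_iff (hC : s.C = (tip s.C).chain) {p : ℝ} :
    π.P s b = some p ↔ (Preceq b (tip s.C) ∧ π.Old s.min b) ∧ π.potential s b = p := by
  rw [P, Preceq, ← hC]
  split_ifs with h
  · rw [Option.some.injEq, potential]
    exact ⟨fun h' => ⟨h, h'⟩, fun h' => h'.2⟩
  · simp [h]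

theorem P_eq_none_iff (hC : s.C = (tip s.C).chain) :
    π.P s b = none ↔ ¬ (Preceq b (tip s.C) ∧ π.Old s.min b) := by
  rw [P, Preceq, ← hC]
  split_ifs with h <;> simp [h]

theorem potential_of_child (hC : s.C = (tip s.C).chain) (hcb : c.parent = some b)
    (hc : Preceq c (tip s.C)) :
    π.potential s b = π.Pwith s b +
      (π.sh + π.sm - π.advOf s c - Min.min (π.lightW s c) π.sh) + π.malW s s.S c := by
  have hn : next s.C b = some c := by
    rw [hC]; exact (next_chain_eq_some (hc.parent hcb)).2 ⟨hcb, hc⟩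
  rw [potential, Psp, hn]
  rfl

theorem potential_tip (hC : s.C = (tip s.C).chain) (hb : b = tip s.C) :
    π.potential s b = π.Pwith s b := by
  have hn : next s.C b = none := by
    rw [hC]; exact (next_chain_eq_none (hb ▸ Preceq.refl _)).2 hb
  rw [potential, Psp, hn]
  simp [Padv]

theorem malW_nonneg (hw : 0 < π.ηw) (T : Finset Block) : 0 ≤ π.malW s T c :=
  totalW_nonneg (weight_nonneg hw)

theorem lightW_nonneg (hw : 0 < π.ηw) : 0 ≤ π.lightW s c :=
  totalW_nonneg (weight_nonneg hw)

theorem ChainStep.v_le_sm (h : π.ChainStep s s') : s'.v ≤ s.v + π.sm := by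
  rw [h.v_eq]
  exact add_le_add_right (min_le_left _ _) _

theorem ChainStep.S_sdiff (h : π.ChainStep s s') :
    s'.S \ s.S = (subT s'.delta (tip s'.C) ∩ s'.M) \ s.S := by
  rw [h.S_eq, Finset.union_sdiff_left]

theorem ChainStep.v_le_malW (h : π.ChainStep s s') :
    s'.v ≤ s.v + π.malW s' s.S (tip s'.C) := by
  rw [h.v_eq, h.S_sdiff]
  exact add_le_add_right (min_le_right _ _) _

/-- What becomes accounted for in `v` is no longer counted in the potential. -/
theorem ChainStep.malW_add_v_le (hw : 0 < π.ηw) (h : π.ChainStep s s')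
    (hc : Preceq c (tip s'.C)) : π.malW s' s'.S c + s'.v ≤ π.malW s' s.S c + s.v := by
  have hv := h.v_le_malW
  have hsum : π.malW s' s'.S c + π.malW s' s.S (tip s'.C) ≤ π.malW s' s.S c := by
    rw [malW, malW, malW, ← totalW_union_of_disjoint]
    · refine totalW_mono (weight_nonneg hw) (Finset.union_subset ?_ ?_)
      · refine Finset.sdiff_subset_sdiff le_rfl ?_
        rw [h.S_eq]; exact Finset.subset_union_left
      · exact Finset.sdiff_subset_sdiff
          (Finset.inter_subset_inter_right (subT_subset_subT le_rfl hc)) le_rfl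
    · rw [Finset.disjoint_left]
      intro x hx hx'
      refine (Finset.mem_sdiff.1 hx).2 ?_
      rw [h.S_eq]
      exact Finset.mem_union_right _ (Finset.mem_sdiff.1 hx').1
  linarith

/-- Malicious weight is measured against the old `S` in both states: by `malW_add_v_le`, what enters
`S` pays for the growth of `v`. -/
theorem potential_step_child (hw : 0 < π.ηw) (hi : π.StateInv s) (h : π.ChainStep s s')
    (hcb : c.parent = some b) (hc : Preceq c (tip s.C)) (hc' : Preceq c (tip s'.C))
    (hle : π.Pwith s' b - π.advOf s' c - Min.min (π.lightW s' c) π.sh + π.malW s' s.S c ≤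
      π.Pwith s b - π.advOf s c - Min.min (π.lightW s c) π.sh + π.malW s s.S c + δ) :
    (π.potential s' b + s'.v) - (π.potential s b + s.v) ≤ δ := by
  rw [potential_of_child hi.chain hcb hc, potential_of_child h.chain hcb hc']
  have := h.malW_add_v_le hw hc'
  linarith

/-- As the light term is capped by `sh`, the old `Padv` is at least `sm - Adv(c)`; this `sm` absorbs
the largest possible growth of `v`. -/
theorem potential_step_cut (hw : 0 < π.ηw) (hi : π.StateInv s) (h : π.ChainStep s s')
    (hcb : c.parent = some b) (hc : Preceq c (tip s.C)) (hb : b = tip s'.C)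
    (hle : π.Pwith s' b + π.advOf s c ≤ π.Pwith s b + δ) :
    (π.potential s' b + s'.v) - (π.potential s b + s.v) ≤ δ := by
  rw [potential_of_child hi.chain hcb hc, potential_tip h.chain hb]
  have h1 := h.v_le_sm
  have h2 := malW_nonneg (s := s) (c := c) hw s.S
  have h3 : Min.min (π.lightW s c) (π.sh : ℝ) ≤ π.sh := min_le_right _ _
  linarith

/-- At a tip only `Pwith` remains, and `v` grows at most by the malicious weight below the tip that
is not yet in `S`. -/
theorem potential_step_tip (hi : π.StateInv s) (h : π.ChainStep s s')
    (hb : b = tip s.C) (hb' : b = tip s'.C)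
    (hle : π.Pwith s' b + π.malW s' s.S b ≤ π.Pwith s b + δ) :
    (π.potential s' b + s'.v) - (π.potential s b + s.v) ≤ δ := by
  rw [potential_tip hi.chain hb, potential_tip h.chain hb']
  have h1 := h.v_le_malW
  rw [← hb'] at h1
  linarith

/-- The bound on the change of the potential, for the blocks of both chains and for the new blocks
of the chain. -/
structure StepBound (π : Params) (s s' : AdvState) (δ : ℝ) : Prop where
  both : ∀ b, Preceq b (tip s.C) → Preceq b (tip s'.C) → π.Old s.min b →
    (π.potential s' b + s'.v) - (π.potential s b + s.v) ≤ δ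
  new : ∀ b, ¬ Preceq b (tip s.C) → Preceq b (tip s'.C) → π.Old s.min b →
    Preceq (tip s.C) b ∧
      (π.potential s' b + s'.v) - (π.potential s (tip s.C) + s.v) ≤ δ

/-! ### Events that do not increase `Adv` -/

theorem adv_le_adv (hw : 0 < π.ηw) {max max' min min' : Finset Block} {f f' : Option Block}
    (hmin : min' ∪ f'.toFinset ⊆ min ∪ f.toFinset) (hmax : max ⊆ max') :
    π.adv max' min' f' c ≤ π.adv max min f c :=
  sub_le_sub (subTW_mono_left (weight_nonneg hw) hmin) (sibSubTW_mono (weight_nonneg hw) hmax)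

/-- Beyond monotonicity, `c` must have been released before: positive `Adv` gives it a descendant in
the old `min ∪ f`. -/
theorem Dom.of_le (hw : 0 < π.ηw) (hi : π.GraphInv s)
    (hmin : s'.min ∪ s'.f.toFinset ⊆ s.min ∪ s.f.toFinset) (hmax : s.max ⊆ s'.max)
    (hc : π.Dom s' c) : π.Dom s c := by
  refine ⟨?_, hc.2.1, hc.2.2.trans_le (adv_le_adv hw hmin hmax)⟩
  refine hi.graph.mem_of_subTW_pos (w := π.weight) (hmin.trans hi.sub) ?_
  have h1 := hc.2.2
  have h2 := sibSubTW_nonneg (w := π.weight) (B := s'.max) (b := c) (weight_nonneg hw)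
  unfold adv at h1
  linarith

/-- A block of the new chain was dominant before. If its parent lies strictly before the old tip,
uniqueness of dominant children puts it on the old chain. If its parent is the old tip, its `Adv`
exceeds `sm + sh` now, hence did so before, against maximality. -/
theorem ChainStep.preceq_of_le (hw : 0 < π.ηw) (hi : π.StateInv s) (h : π.ChainStep s s')
    (hmin : s'.min ∪ s'.f.toFinset ⊆ s.min ∪ s.f.toFinset) (hmax : s.max ⊆ s'.max)
    (hb : Preceq b (tip s'.C)) : Preceq b (tip s.C) := by
  induction b using parent_induction with
  | genesis => exact genesis_preceq _
  | step b p hp ih =>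
    have hpt := ih ((Preceq.refl b).parent hp |>.trans hb)
    have hdom' := h.dom hb (ne_genesis_of_parent hp)
    have hdom := hdom'.of_le hw hi.toGraphInv hmin hmax
    by_cases e : p = tip s.C
    · subst e
      have h1 := hi.maximal b hp hdom
      have h2 := h.lt_adv hb
        ⟨(Preceq.refl b).parent hp, fun e => (rank_parent hp).ne (by rw [e])⟩
      have h3 : π.advOf s' b ≤ π.advOf s b := adv_le_adv hw hmin hmax
      linarith
    · obtain ⟨c, hcp, hct⟩ := exists_child_of_preceq hpt e
      have hc := (hi.dom c hct).resolve_left (ne_genesis_of_parent hcp)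
      rwa [hdom.eq_of_parent hw hi.sub hc (hp.trans hcp.symm)]

/-- The members of the old chain that keep a positive `Adv` stay in the chain. -/
theorem ChainStep.keep (h : π.ChainStep s s') (hb : Preceq b (tip s'.C))
    (hcb : c.parent = some b) (hc : Preceq c (tip s.C)) (hdom : π.Dom s' c) :
    Preceq c (tip s'.C) :=
  h.extend hb hcb hdom fun hp => absurd (hp.1.antisymm hc) hp.2

/-- The chain can only lose a suffix. A block of both chains is the tip of both, or keeps its
successor `c`, or becomes the tip because `c` is cut off; the last three hypotheses treat these
positions. -/
theorem stepBound_of_le (hw : 0 < π.ηw) (hi : π.StateInv s) (h : π.ChainStep s s')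
    (hmin : s'.min ∪ s'.f.toFinset ⊆ s.min ∪ s.f.toFinset) (hmax : s.max ⊆ s'.max)
    (htip : ∀ b, b = tip s.C → b = tip s'.C → π.Old s.min b →
      π.Pwith s' b + π.malW s' s.S b ≤ π.Pwith s b + δ)
    (hchild : ∀ b c, c.parent = some b → Preceq c (tip s.C) → Preceq c (tip s'.C) →
      π.Old s.min b →
      π.Pwith s' b - π.advOf s' c - Min.min (π.lightW s' c) π.sh + π.malW s' s.S c ≤
        π.Pwith s b - π.advOf s c - Min.min (π.lightW s c) π.sh + π.malW s s.S c + δ)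
    (hcut : ∀ b c, c.parent = some b → Preceq c (tip s.C) → Preceq b (tip s'.C) →
      π.Old s.min b → π.advOf s' c ≤ 0 → π.Pwith s' b + π.advOf s c ≤ π.Pwith s b + δ) :
    π.StepBound s s' δ where
  both b hb hb' hold := by
    by_cases e : b = tip s.C
    · have e' : b = tip s'.C := by
        refine hb'.antisymm ?_
        rw [e]
        exact h.preceq_of_le hw hi hmin hmax (Preceq.refl _)
      exact potential_step_tip hi h e e' (htip b e e' hold)
    · obtain ⟨c, hcb, hc⟩ := exists_child_of_preceq hb e
      by_cases hc' : Preceq c (tip s'.C)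
      · exact potential_step_child hw hi h hcb hc hc' (hchild b c hcb hc hc' hold)
      · have hdom := (hi.dom c hc).resolve_left (ne_genesis_of_parent hcb)
        have hadv : π.advOf s' c ≤ 0 := by
          by_contra hpos
          exact hc' (h.keep hb' hcb hc ⟨hmax hdom.1, hdom.2.1, not_le.1 hpos⟩)
        -- Another child of `b` on the new chain would lie on the old chain too, next to `c`.
        have e' : b = tip s'.C := by
          by_contra e'
          obtain ⟨d, hdb, hd⟩ := exists_child_of_preceq hb' e'
          have hd' := h.preceq_of_le hw hi hmin hmax hd
          exact hc' (eq_of_preceq_of_parent hc hd' hcb hdb ▸ hd)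
        exact potential_step_cut hw hi h hcb hc e' (hcut b c hcb hc hb' hold hadv)
  new b hb hb' _ := absurd (h.preceq_of_le hw hi hmin hmax hb') hb

/-! ### Events that keep the chain -/

/-- The threshold applies only strictly beyond the old tip, so a chain that stays dominant survives.
By `hmal` and the invariant `special`, all unknown malicious blocks from the old tip on are in `S`,
so `v` does not grow and `Psp` vanishes there. -/
theorem stepBound_of_keep (hw : 0 < π.ηw) (hi : π.StateInv s) (h : π.ChainStep s s')
    (hdom : ∀ c, c ≠ genesis → Preceq c (tip s.C) → π.Dom s' c)
    (hwith : ∀ b, π.Pwith s' b ≤ π.Pwith s b)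
    (hmal : subT s'.delta (tip s.C) ∩ s'.M ⊆ subT s.delta (tip s.C) ∩ s.M)
    (hchild : ∀ b c, c.parent = some b → Preceq c (tip s.C) → Preceq c (tip s'.C) →
      π.Old s.min b →
      π.Pwith s' b - π.advOf s' c - Min.min (π.lightW s' c) π.sh + π.malW s' s.S c ≤
        π.Pwith s b - π.advOf s c - Min.min (π.lightW s c) π.sh + π.malW s s.S c + δ)
    (htip : Preceq (tip s.C) (tip s'.C) → π.Old s.min (tip s'.C) → 0 ≤ δ)
    (hnext : ∀ b c, c.parent = some b → Preceq (tip s.C) b → Preceq c (tip s'.C) →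
      π.Old s.min b → π.sh + π.sm - π.advOf s' c ≤ δ) :
    π.StepBound s s' δ := by
  have hw' := weight_nonneg hw
  have hsub : ∀ b, Preceq b (tip s.C) → Preceq b (tip s'.C) := fun b hb => by
    induction b using parent_induction with
    | genesis => exact genesis_preceq _
    | step b p hp ih =>
      exact h.keep (ih ((Preceq.refl b).parent hp |>.trans hb)) hp hb
        (hdom b (ne_genesis_of_parent hp) hb)
  have htt := hsub _ (Preceq.refl _)
  have hmal0 : ∀ c T, s.S ⊆ T → Preceq (tip s.C) c → π.malW s' T c = 0 := by
    intro c T hT hc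
    rw [malW, Finset.sdiff_eq_empty_iff_subset.2, totalW, Finset.sum_empty]
    refine ((Finset.inter_subset_inter_right (subT_subset_subT le_rfl hc)).trans hmal).trans ?_
    exact hi.special.trans hT
  have hv : s'.v ≤ s.v := by
    have := h.v_le_malW
    rwa [hmal0 _ s.S le_rfl htt, add_zero] at this
  -- The same estimate serves the old tip and every block added after it, since the old potential at
  -- the tip is just `Pwith`.
  have habove : ∀ b, Preceq (tip s.C) b → Preceq b (tip s'.C) → π.Old s.min b →
      (π.potential s' b + s'.v) - (π.potential s (tip s.C) + s.v) ≤ δ := by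
    intro b htb hb' hold
    have hPw : π.Pwith s' b ≤ π.Pwith s (tip s.C) :=
      (subTW_mono hw' le_rfl htb).trans (hwith _)
    rw [potential_tip hi.chain rfl]
    by_cases e : b = tip s'.C
    · rw [potential_tip h.chain e]
      have := htip htt (e ▸ hold)
      linarith
    · obtain ⟨c, hcb, hc⟩ := exists_child_of_preceq hb' e
      have hbc : Preceq b c := (Preceq.refl c).parent hcb
      rw [potential_of_child h.chain hcb hc, hmal0 c s'.S _ (htb.trans hbc)]
      · have h1 := hnext b c hcb htb hc hold
        have h2 : 0 ≤ Min.min (π.lightW s' c) (π.sh : ℝ) :=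
          le_min (lightW_nonneg hw) (Nat.cast_nonneg _)
        linarith
      · rw [h.S_eq]; exact Finset.subset_union_left
  refine ⟨fun b hb hb' hold => ?_, fun b hb hb' hold => ?_⟩
  · by_cases e : b = tip s.C
    · subst e
      exact habove _ (Preceq.refl _) hb' hold
    · obtain ⟨c, hcb, hc⟩ := exists_child_of_preceq hb e
      exact potential_step_child hw hi h hcb hc (hsub c hc)
        (hchild b c hcb hc (hsub c hc) hold)
  · have htb : Preceq (tip s.C) b := (htt.total hb').resolve_right hb
    exact ⟨htb, habove b htb hb' hold⟩

end potential

section malicious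

variable {s : AdvState} {e : Event}

/-! ## Malicious events and receptions -/

/-- An unreleased block lies outside `max`, hence outside every term except `Pwith`. -/
theorem stepBound_mGen (hw : 0 < π.ηw) (hi : π.StateInv s) (he : π.Admissible s e)
    (hg : π.GraphInv (π.ψ s e)) (ht : e.type = .mGen) :
    π.StepBound s (π.ψ s e) (π.eventValue s e) := by
  have hx := he.mGen ht
  have hmax : (π.ψ s e).max = s.max := by simp [ψ, Event.IsRls, ht]
  have hmin : (π.ψ s e).min = s.min := by simp [ψ, ht]
  have hM : (π.ψ s e).M = insert e.block s.M := by simp [ψ, ht]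
  have hgen : (π.ψ s e).gen = insert e.block s.gen := by simp [ψ, Event.IsGen, ht]
  have hf : (π.ψ s e).f = s.f := newFlag_eq_self (.inl ht)
  have hΔ : (π.ψ s e).delta = s.delta := by rw [AdvState.delta, hmax, hmin, AdvState.delta]
  have hval : π.eventValue s e = π.weight e.block := by simp [eventValue, ht]
  rw [hval]
  generalize hs' : π.ψ s e = s' at *
  have h : π.ChainStep s s' := hs' ▸ chainStep_ψ hw (hs' ▸ hg)
  have hw' := weight_nonneg hw
  have hwith : ∀ b, π.Pwith s' b ≤ π.Pwith s b + π.weight e.block := fun b => by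
    rw [Pwith, hmax, hgen, Pwith, Finset.insert_sdiff_of_notMem _ hx]
    exact subTW_insert_le hw'
  have hadv : ∀ c, π.advOf s' c = π.advOf s c := fun c => by rw [advOf, hmax, hmin, hf]
  have hmal : ∀ c, π.malW s' s.S c = π.malW s s.S c := fun c => by
    rw [malW, malW, hΔ, hM, Finset.inter_insert_of_notMem]
    exact fun h => hx (Finset.mem_sdiff.1 (mem_subT.1 h).1).1
  have hlight : ∀ c, π.lightW s' c = π.lightW s c := fun c => by
    rw [lightW, lightW, lightHonest, lightHonest, hΔ, hmax, hM, Finset.sdiff_insert,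
      Finset.erase_eq_of_notMem]
    exact fun h => hx (Finset.mem_sdiff.1 h).1
  refine stepBound_of_le hw hi h (by rw [hmin, hf]) hmax.ge ?_ ?_ ?_
  · intro b e1 _ _
    rw [hmal, malW, Finset.sdiff_eq_empty_iff_subset.2 (e1 ▸ hi.special), totalW,
      Finset.sum_empty, add_zero]
    exact hwith b
  · intro b c _ _ _ _
    rw [hadv, hmal, hlight]
    linarith [hwith b]
  · intro b c hcb hc _ _ hneg
    rw [hadv] at hneg
    exact absurd ((hi.dom c hc).resolve_left (ne_genesis_of_parent hcb)).2.2 (not_lt.2 hneg)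

/-- The weight that leaves `Pwith` can be spent once: below `c` it enters the malicious term and
spares the siblings of `c`; elsewhere below `b` it can only lower `Adv(c)`. -/
theorem stepBound_mRls (hw : 0 < π.ηw) (hi : π.StateInv s) (he : π.Admissible s e)
    (hg : π.GraphInv (π.ψ s e)) (ht : e.type = .mRls) :
    π.StepBound s (π.ψ s e) (π.eventValue s e) := by
  obtain ⟨hxg, hxM, hx, -⟩ := he.mRls ht
  have hmax : (π.ψ s e).max = insert e.block s.max := by simp [ψ, Event.IsRls, ht]
  have hmin : (π.ψ s e).min = s.min := by simp [ψ, ht]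
  have hM : (π.ψ s e).M = s.M := by simp [ψ, ht]
  have hgen : (π.ψ s e).gen = s.gen := by simp [ψ, Event.IsGen, ht]
  have hf : (π.ψ s e).f = s.f := newFlag_eq_self (.inr ht)
  have hxmin : e.block ∉ s.min := fun h => hx (hi.min_sub h)
  have hΔ : (π.ψ s e).delta = insert e.block s.delta := by
    rw [AdvState.delta, hmax, hmin, AdvState.delta, Finset.insert_sdiff_of_notMem _ hxmin]
  have hval : π.eventValue s e = 0 := by simp [eventValue, ht]
  rw [hval]
  generalize hs' : π.ψ s e = s' at *
  generalize e.block = x at *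
  have h : π.ChainStep s s' := hs' ▸ chainStep_ψ hw (hs' ▸ hg)
  have hw' := weight_nonneg hw
  have hgm : s.gen \ s.max = insert x (s'.gen \ s'.max) := by
    rw [hgen, hmax, Finset.sdiff_insert, Finset.insert_erase (Finset.mem_sdiff.2 ⟨hxg, hx⟩)]
  have hxgm : x ∉ s'.gen \ s'.max := by rw [hmax]; simp
  have hwith : ∀ b, Preceq b x → π.Pwith s b = π.Pwith s' b + π.weight x := fun b hb => by
    rw [Pwith, hgm, subTW_insert hb hxgm, Pwith]
  have hwith' : ∀ b, ¬ Preceq b x → π.Pwith s b = π.Pwith s' b := fun b hb => by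
    rw [Pwith, hgm, subTW_insert_of_not_preceq hb, Pwith]
  have hmal : ∀ c, ¬ Preceq c x → π.malW s' s.S c = π.malW s s.S c := fun c hc => by
    rw [malW, malW, hΔ, hM, subT_insert_of_not_preceq hc]
  have hmal' : ∀ c, π.malW s' s.S c ≤ π.malW s s.S c + π.weight x := fun c => by
    refine le_trans (totalW_mono hw' ?_) (totalW_insert_le hw')
    intro y hy
    rw [hΔ, hM] at hy
    simp only [Finset.mem_sdiff, Finset.mem_inter, mem_subT, Finset.mem_insert] at hy ⊢
    tauto
  have hlight : ∀ c, π.lightW s' c = π.lightW s c := fun c => by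
    rw [lightW, lightW]
    congr 1
    ext y
    simp only [lightHonest, hΔ, hmax, hM, Finset.mem_inter, mem_subT, Finset.mem_insert,
      Finset.mem_filter, Finset.mem_sdiff]
    constructor
    · rintro ⟨⟨h1, h2⟩, ⟨h3, h4⟩, h5⟩
      have hyx : y ≠ x := fun e1 => h4 (e1 ▸ hxM)
      tauto
    · tauto
  have hadv : ∀ c, π.advOf s c ≤ π.advOf s' c + π.weight x := fun c => by
    have := hi.graph.sibSubTW_insert_le (b := c) (x := x) hw'
    rw [advOf, advOf, hmin, hf, hmax, adv, adv]
    linarith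
  have hadv' : ∀ b c, c.parent = some b → (Preceq b x → Preceq c x) →
      π.advOf s' c = π.advOf s c := fun b c hcb hbc => by
    rw [advOf, advOf, hmin, hf, hmax, adv, adv, hi.graph.sibSubTW_insert hw']
    intro d hd hne hdx
    rw [hcb] at hd
    have hbx : Preceq b x := ((Preceq.refl d).parent hd).trans hdx
    exact hne (eq_of_preceq_of_parent hdx (hbc hbx) hd hcb)
  have hnil : ∀ b, b = tip s.C → π.malW s s.S b = 0 := fun b e1 => by
    rw [malW, Finset.sdiff_eq_empty_iff_subset.2 (e1 ▸ hi.special), totalW, Finset.sum_empty]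
  refine stepBound_of_le hw hi h (by rw [hmin, hf]) (hmax ▸ Finset.subset_insert _ _) ?_ ?_ ?_
  · intro b e1 _ _
    have h0 := hnil b e1
    by_cases hb : Preceq b x
    · linarith [hwith b hb, hmal' b]
    · linarith [hwith' b hb, hmal b hb]
  · intro b c hcb _ _ _
    rw [hlight]
    have hbc : Preceq b c := (Preceq.refl c).parent hcb
    by_cases hb : Preceq b x
    · by_cases hc : Preceq c x
      · linarith [hwith b hb, hmal' c, hadv' b c hcb fun _ => hc]
      · linarith [hwith b hb, hmal c hc, hadv c]
    · linarith [hwith' b hb, hmal c fun hc => hb (hbc.trans hc),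
        hadv' b c hcb fun hb' => absurd hb' hb]
  · intro b c hcb hc _ _ hneg
    have hpos := ((hi.dom c hc).resolve_left (ne_genesis_of_parent hcb)).2.2
    by_cases hb : Preceq b x
    -- `Adv(c)` drops to at most 0, so its old value was at most the weight that leaves `Pwith`.
    · linarith [hwith b hb, hadv c]
    · have := hadv' b c hcb fun hb' => absurd hb' hb
      rw [this] at hneg
      exact absurd hpos (not_lt.2 hneg)

/-- Reception only enlarges `min ∪ f`, so `Adv` cannot fall; a received light block below `c` leaves
the capped term but adds 1 to `Adv(c)`. -/
theorem stepBound_arvl (hw : 0 < π.ηw) (hi : π.StateInv s)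
    (hg : π.GraphInv (π.ψ s e)) (ht : e.type = .arvl) :
    π.StepBound s (π.ψ s e) (π.eventValue s e) := by
  have hmax : (π.ψ s e).max = s.max := by simp [ψ, Event.IsRls, ht]
  have hmin : (π.ψ s e).min = insert e.block s.min := by simp [ψ, ht]
  have hM : (π.ψ s e).M = s.M := by simp [ψ, ht]
  have hgen : (π.ψ s e).gen = s.gen := by simp [ψ, Event.IsGen, ht]
  have hf : (π.ψ s e).f = if s.f = some e.block then none else s.f := newFlag_arvl ht
  have hval : π.eventValue s e = 0 := by simp [eventValue, ht]
  rw [hval]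
  generalize hs' : π.ψ s e = s' at *
  generalize e.block = x at *
  have h : π.ChainStep s s' := hs' ▸ chainStep_ψ hw (hs' ▸ hg)
  have hw' := weight_nonneg hw
  -- An arriving flag block moves from `f` to `min` and leaves the union unchanged; one formula
  -- covers both cases.
  have hmf : s'.min ∪ s'.f.toFinset = insert x (s.min ∪ s.f.toFinset) := by
    rw [hmin, hf]
    split_ifs with hfx
    · rw [hfx]
      ext y; simp
    · rw [Finset.insert_union]
  have hadv : ∀ c, π.advOf s c ≤ π.advOf s' c := fun c => by
    rw [advOf, advOf, adv, adv, hmf, hmax]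
    exact sub_le_sub_right (subTW_mono_left hw' (Finset.subset_insert _ _)) _
  have hΔ : s'.delta ⊆ s.delta := by
    rw [AdvState.delta, AdvState.delta, hmax, hmin]
    exact Finset.sdiff_subset_sdiff le_rfl (Finset.subset_insert _ _)
  have hwith : ∀ b, π.Pwith s' b = π.Pwith s b := fun b => by rw [Pwith, Pwith, hgen, hmax]
  have hmal : ∀ c T, π.malW s' T c ≤ π.malW s T c := fun c T => by
    refine totalW_mono hw' (Finset.sdiff_subset_sdiff ?_ le_rfl)
    rw [hM]
    exact Finset.inter_subset_inter_right (subT_subset_subT hΔ (Preceq.refl c))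
  have hN : π.lightHonest s' = π.lightHonest s := by rw [lightHonest, lightHonest, hmax, hM]
  have hlight : ∀ c, π.lightW s c ≤ π.lightW s' c + (π.advOf s' c - π.advOf s c) := by
    intro c
    by_cases hx : x ∈ subT s.delta c ∩ π.lightHonest s
    · rw [Finset.mem_inter, mem_subT, lightHonest, Finset.mem_filter, AdvState.delta,
        Finset.mem_sdiff] at hx
      obtain ⟨⟨⟨hx1, hx2⟩, hx3⟩, -, hx4⟩ := hx
      -- A flag block would already be counted in `Adv`, but its weight is `ηw ≠ 1`, so it is not
      -- light.
      have hxf : s.f ≠ some x := fun hfx => by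
        obtain ⟨-, h1, h2⟩ := hi.flag x hfx
        exact h2 (h1.symm.trans hx4)
      have hxmf : x ∉ s.min ∪ s.f.toFinset := by
        simp [hx2, hxf]
      have h1 : π.advOf s' c = π.advOf s c + 1 := by
        rw [advOf, advOf, adv, adv, hmf, hmax, subTW_insert hx3 hxmf, hx4]
        ring
      rw [h1, add_sub_cancel_left, ← hx4]
      refine (totalW_mono hw' ?_).trans (totalW_insert_le hw')
      rw [hN, AdvState.delta, AdvState.delta, hmax, hmin]
      intro y hy
      simp only [Finset.mem_inter, mem_subT, Finset.mem_insert, Finset.mem_sdiff] at hy ⊢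
      tauto
    · refine le_add_of_le_of_nonneg (totalW_mono hw' ?_) (sub_nonneg.2 (hadv c))
      intro y hy
      have hyx : y ≠ x := by rintro rfl; exact hx hy
      rw [hN, AdvState.delta, hmax, hmin]
      rw [AdvState.delta] at hy
      simp only [Finset.mem_inter, mem_subT, Finset.mem_insert, Finset.mem_sdiff] at hy ⊢
      tauto
  refine stepBound_of_keep hw hi h ?_ (fun b => (hwith b).le) ?_ ?_ (fun _ _ => le_rfl) ?_
  · intro c hcg hc
    have hd := (hi.dom c hc).resolve_left hcg
    exact ⟨hmax ▸ hd.1, hd.2.1, hd.2.2.trans_le (hadv c)⟩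
  · rw [hM]
    exact Finset.inter_subset_inter_right (subT_subset_subT hΔ (Preceq.refl _))
  · intro b c _ _ _ _
    have h1 : Min.min (π.lightW s c) (π.sh : ℝ) ≤
        Min.min (π.lightW s' c) π.sh + (π.advOf s' c - π.advOf s c) := by
      rcases le_total (π.lightW s' c) (π.sh : ℝ) with h2 | h2
      · rw [min_eq_left h2]
        exact (min_le_left _ _).trans (hlight c)
      · rw [min_eq_right h2]
        exact (min_le_right _ _).trans (le_add_of_nonneg_right (sub_nonneg.2 (hadv c)))
    rw [hwith]
    linarith [hmal c s.S]
  · intro b c hcb htb hc _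
    have hbc : Preceq b c := (Preceq.refl c).parent hcb
    have := h.lt_adv hc ⟨htb.trans hbc, fun e1 => not_preceq_parent hcb (e1 ▸ htb)⟩
    linarith

end malicious

section honest

variable {s : AdvState} {e : Event}

/-! ## Honest block generation -/

variable {x b c : Block}

theorem GraphInv.adv_le_of_flag (hw : 0 < π.ηw) (hi : π.GraphInv s) (c : Block) :
    π.advOf s c ≤ π.adv s.max s.min none c + π.ηw := by
  rw [advOf, adv, adv]
  cases hf : s.f with
  | none => simpa using hw.le
  | some y =>
    have h1 := (hi.flag y hf).2.1
    have h2 := subTW_insert_le (w := π.weight) (B := s.min) (x := y) (b := c) (weight_nonneg hw)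
    have h3 : s.min ∪ (some y).toFinset = insert y s.min := by ext z; simp
    have h4 : s.min ∪ (none : Option Block).toFinset = s.min := by simp
    rw [h3, h4]
    linarith

theorem adv_none (max min : Finset Block) (c : Block) :
    π.adv max min none c = subTW π.weight min c - sibSubTW π.weight max c := by
  simp [adv]

/-- Without a flag block, an honest block extends the chain of the adversary state. -/
theorem StateInv.preceq_of_flag_none (hw : 0 < π.ηw) (hi : π.StateInv s) (hx : π.Valid x)
    (hxmax : x ∉ s.max) (hL : s.min ⊆ x.past) (hU : x.past ⊆ s.max) (hf : s.f = none)
    (hc : Preceq c (tip s.C)) : Preceq c x := by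
  induction c using parent_induction with
  | genesis => exact genesis_preceq _
  | step c p hp ih =>
    have hpc : Preceq p c := (Preceq.refl c).parent hp
    have hd := (hi.dom c hc).resolve_left (ne_genesis_of_parent hp)
    have hpx : p ≠ x := fun e1 => hxmax (e1 ▸ hi.graph.mem_of_preceq hpc hd.1)
    have hadv := hd.2.2
    -- Without a flag, positive `Adv` compares `min` with `max`, between which the past graph of `x`
    -- lies.
    rw [hf, adv_none, sub_pos] at hadv
    exact hx.preceq_of_dominant hw hL hU (ih (hpc.trans hc)) hpx hp hd.2.1 hadv

/-- An honest block of weight `1` extends the old part of the chain. -/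
theorem StateInv.preceq_of_light (hw : 0 < π.ηw)
    (ha : 2 * (π.sm : ℝ) + 2 * π.sh + 2 * π.ηw ≤ π.ηa) (hi : π.StateInv s) (hx : π.Valid x)
    (hxmax : x ∉ s.max) (hL : s.min ⊆ x.past) (hU : x.past ⊆ s.max)
    (h1 : π.weight x = 1) (h1' : π.ηw ≠ 1)
    (hc : Preceq c (tip s.C)) (hold : ∀ p, c.parent = some p → π.Old s.min p) :
    Preceq c x := by
  have hw' := weight_nonneg hw
  induction c using parent_induction with
  | genesis => exact genesis_preceq _
  | step c p hp ih =>
    have hpc : Preceq p c := (Preceq.refl c).parent hp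
    have hd := (hi.dom c hc).resolve_left (ne_genesis_of_parent hp)
    have hpx : p ≠ x := fun e1 => hxmax (e1 ▸ hi.graph.mem_of_preceq hpc hd.1)
    have hpx' : Preceq p x := ih (hpc.trans hc) fun q hq =>
      (hold p hp).mono le_rfl ((Preceq.refl p).parent hq)
    obtain ⟨d, hdp, hdx, hdm, hwd, hdη⟩ := hx.exists_dominant_child
      (not_adaptCon_of_weight_eq_one h1 h1') hpx' hpx ((hold p hp).mono hL (Preceq.refl p))
    by_contra hcx
    have hne : c ≠ d := fun e1 => hcx (e1 ▸ hdx)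
    -- In the past of `x`, `d` beats `c` by `ηa`; in the adversary state, `c` beats `d` once the
    -- flag is counted. Together this gives `ηa < ηw`, against `ha`.
    have hgr := isGraph_past hx.1
    have e1 : subTW π.weight s.min c ≤ subTW π.weight x.past c := subTW_mono_left hw' hL
    have e2 := hgr.subTW_le_sibSubTW hw' (hp.trans hdp.symm) hd.2.1 hne
    have e3 : subTW π.weight x.past d ≤ subTW π.weight s.max d := subTW_mono_left hw' hU
    have e4 := subTW_le_sibSubTW_of_mem (w := π.weight) (hU hdm) (hdp.trans hp.symm) hwd
      hne.symm
    have e5 := hi.adv_le_of_flag hw c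
    rw [adv_none] at e5
    have e6 := hd.2.2
    have e7 : (0 : ℝ) ≤ π.sm := Nat.cast_nonneg _
    have e8 : (0 : ℝ) ≤ π.sh := Nat.cast_nonneg _
    linarith

/-- Without the special status, no honest block of weight `1` is generated when the tip of the
chain is old. -/
theorem StateInv.not_old_tip_of_light (hw : 0 < π.ηw)
    (ha : 2 * (π.sm : ℝ) + 2 * π.sh + 2 * π.ηw ≤ π.ηa) (hi : π.StateInv s) (hx : π.Valid x)
    (hxmax : x ∉ s.max) (hL : s.min ⊆ x.past) (hU : x.past ⊆ s.max)
    (h1 : π.weight x = 1) (h1' : π.ηw ≠ 1) (hspe : ¬ π.Spe s) :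
    ¬ π.Old s.min (tip s.C) := by
  intro hold
  have hw' := weight_nonneg hw
  have htx : Preceq (tip s.C) x := hi.preceq_of_light hw ha hx hxmax hL hU h1 h1'
    (Preceq.refl _) fun q hq => hold.mono le_rfl ((Preceq.refl _).parent hq)
  have htm : tip s.C ∈ s.max := by
    rcases hi.dom _ (Preceq.refl _) with h | h
    · exact h ▸ hi.graph.1
    · exact h.1
  obtain ⟨d, hdp, hdx, hdm, hwd, hdη⟩ := hx.exists_dominant_child
    (not_adaptCon_of_weight_eq_one h1 h1') htx (fun e1 => hxmax (e1 ▸ htm))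
    (hold.mono hL (Preceq.refl _))
  -- The margin `ηa` loses less than the unknown weight bound `sm + sh + 2 * ηw`, so more than `sm +
  -- sh` remains and `d` should have prolonged the chain.
  have e1 := sub_sibSubTW_le (isGraph_past hx.1) hw' hL hU hdp
  have e2 := subTW_delta_lt_two hw hspe
  rw [AdvState.delta] at e2
  have e3 : subTW π.weight s.min d ≤ subTW π.weight (s.min ∪ s.f.toFinset) d :=
    subTW_mono_left hw' Finset.subset_union_left
  have e4 : (π.sm : ℝ) + π.sh < π.advOf s d := by
    rw [advOf, adv]
    linarith
  have e7 : (0 : ℝ) ≤ π.sm := Nat.cast_nonneg _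
  have e8 : (0 : ℝ) ≤ π.sh := Nat.cast_nonneg _
  have := hi.maximal d hdp ⟨hU hdm, hwd, by linarith⟩
  linarith

/-- The effect of an honest block generation on the graphs. -/
theorem hGenRls_fields (ht : e.type = .hGenRls) :
    (π.ψ s e).max = insert e.block s.max ∧ (π.ψ s e).min = s.min ∧ (π.ψ s e).M = s.M ∧
      (π.ψ s e).gen = insert e.block s.gen := by
  simp [ψ, Event.IsRls, Event.IsGen, ht]

variable {s' : AdvState}

/-- The adversary state `s'` arises from `s` by adding the honest block `x`. -/
structure HonestStep (π : Params) (s s' : AdvState) (x : Block) : Prop where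
  valid : π.Valid x
  not_mem_max : x ∉ s.max
  not_mem_M : x ∉ s.M
  min_sub : s.min ⊆ x.past
  sub_max : x.past ⊆ s.max
  max_eq : s'.max = insert x s.max
  min_eq : s'.min = s.min
  M_eq : s'.M = s.M
  gen_eq : s'.gen = insert x s.gen

theorem honestStep_ψ (he : π.Admissible s e) (ht : e.type = .hGenRls) :
    π.HonestStep s (π.ψ s e) e.block := by
  obtain ⟨h1, h2, h3, h4, h5⟩ := he.hGenRls ht
  obtain ⟨g1, g2, g3, g4⟩ := hGenRls_fields (π := π) (s := s) ht
  exact ⟨h1, h2, h3, h4, h5, g1, g2, g3, g4⟩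

theorem HonestStep.delta_eq (h : π.HonestStep s s' x) (hi : π.GraphInv s) :
    s'.delta = insert x s.delta := by
  have hx : x ∉ s.min := fun hx => h.not_mem_max (hi.min_sub hx)
  rw [AdvState.delta, h.max_eq, h.min_eq, AdvState.delta, Finset.insert_sdiff_of_notMem _ hx]

theorem HonestStep.not_mem_delta (h : π.HonestStep s s' x) : x ∉ s.delta := fun hx =>
  h.not_mem_max (Finset.mem_sdiff.1 hx).1

/-- An honest block enters `gen` and `max` together, so it is never withheld. -/
theorem HonestStep.Pwith_le (hw : 0 < π.ηw) (h : π.HonestStep s s' x) (b : Block) :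
    π.Pwith s' b ≤ π.Pwith s b := by
  refine subTW_mono_left (weight_nonneg hw) ?_
  rw [h.gen_eq, h.max_eq]
  intro y
  simp only [Finset.mem_sdiff, Finset.mem_insert]
  tauto

theorem HonestStep.subT_inter_M (h : π.HonestStep s s' x) (hi : π.GraphInv s) (c : Block) :
    subT s'.delta c ∩ s'.M = subT s.delta c ∩ s.M := by
  ext y
  have : y ∈ s.M → y ≠ x := fun hy e1 => h.not_mem_M (e1 ▸ hy)
  rw [h.delta_eq hi, h.M_eq]
  simp only [Finset.mem_inter, mem_subT, Finset.mem_insert]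
  tauto

theorem HonestStep.malW_eq (h : π.HonestStep s s' x) (hi : π.GraphInv s) (T : Finset Block)
    (c : Block) : π.malW s' T c = π.malW s T c := by
  rw [malW, malW, h.subT_inter_M hi]

theorem HonestStep.lightHonest_eq (h : π.HonestStep s s' x) :
    π.lightHonest s' =
      if π.weight x = 1 then insert x (π.lightHonest s) else π.lightHonest s := by
  rw [lightHonest, h.max_eq, h.M_eq, Finset.insert_sdiff_of_notMem _ h.not_mem_M,
    Finset.filter_insert, lightHonest]

theorem HonestStep.lightW_le (hw : 0 < π.ηw) (h : π.HonestStep s s' x) (hi : π.GraphInv s)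
    (c : Block) : π.lightW s c ≤ π.lightW s' c := by
  refine totalW_mono (weight_nonneg hw) (Finset.inter_subset_inter ?_ ?_)
  · rw [h.delta_eq hi]
    exact subT_subset_subT (Finset.subset_insert _ _) (Preceq.refl c)
  · rw [h.lightHonest_eq]
    split_ifs
    · exact Finset.subset_insert _ _
    · exact le_rfl

theorem HonestStep.lightW_eq_add_one (h : π.HonestStep s s' x) (hi : π.GraphInv s)
    (h1 : π.weight x = 1) (hc : Preceq c x) : π.lightW s' c = π.lightW s c + 1 := by
  rw [lightW, h.delta_eq hi, h.lightHonest_eq, if_pos h1, subT_insert_of_preceq hc,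
    ← Finset.insert_inter_distrib, totalW, Finset.sum_insert, h1, add_comm]
  · rfl
  · exact fun hx => h.not_mem_delta (mem_subT.1 (Finset.mem_inter.1 hx).1).1

/-- This links the light term to the second clause of `Spe`: without the special status there is
room under the cap for one more light block. -/
theorem lightW_le_card (s : AdvState) (c : Block) :
    π.lightW s c ≤ ((s.delta \ s.M).filter fun b => π.weight b = 1).card := by
  have h1 : ∀ y ∈ subT s.delta c ∩ π.lightHonest s, π.weight y = 1 := fun y hy =>
    (Finset.mem_filter.1 (Finset.mem_inter.1 hy).2).2
  rw [lightW, totalW, Finset.sum_congr rfl h1, Finset.sum_const, nsmul_one]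
  refine Nat.cast_le.2 (Finset.card_le_card fun y hy => ?_)
  rw [lightHonest, Finset.mem_inter, mem_subT, Finset.mem_filter, Finset.mem_sdiff] at hy
  rw [Finset.mem_filter, Finset.mem_sdiff]
  tauto

/-- The set `min ∪ f` is unchanged, so `x` could matter only through the siblings of `c`; a
descendant of `c` lies below none of them. -/
theorem HonestStep.adv_eq_of_preceq (hw : 0 < π.ηw) (h : π.HonestStep s s' x)
    (hi : π.GraphInv s) (hf : s'.f = s.f) (hc : c ≠ genesis)
    (hcx : π.weight x = 0 ∨ Preceq c x) : π.advOf s' c = π.advOf s c := by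
  have hw' := weight_nonneg hw
  rw [advOf, advOf, adv, adv, h.min_eq, hf, h.max_eq]
  congr 1
  rcases hcx with hcx | hcx
  · refine le_antisymm ?_ (sibSubTW_mono hw' (Finset.subset_insert _ _))
    simpa [hcx] using hi.graph.sibSubTW_insert_le (b := c) (x := x) hw'
  · exact hi.graph.sibSubTW_insert_of_preceq hw' hc hcx

/-- Honest block generation that leaves the flag block unchanged. -/
theorem stepBound_hGenRls_of_flag_eq (hw : 0 < π.ηw)
    (hs : 2 * (π.sh : ℝ) + 2 * π.sm ≤ π.ηw)
    (ha : 2 * (π.sm : ℝ) + 2 * π.sh + 2 * π.ηw ≤ π.ηa) (hi : π.StateInv s)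
    (hx : π.HonestStep s s' x) (h : π.ChainStep s s') (hf : s'.f = s.f)
    (hheavy : π.weight x = π.ηw → s.f = none) {δ : ℝ}
    (hδ : 0 ≤ δ ∨ (π.weight x = 1 ∧ ¬ π.Spe s ∧ δ = -1)) : π.StepBound s s' δ := by
  have hw' := weight_nonneg hw
  -- When there is a flag, `hheavy` excludes heavy blocks and a light block follows by its
  -- optimistic margin; only a weightless block may leave the chain.
  have hfollow : ∀ b c, c.parent = some b → Preceq c (tip s.C) → π.Old s.min b →
      π.weight x = 0 ∨ Preceq c x := by
    intro b c hcb hc hold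
    by_cases hfn : s.f = none
    · exact .inr (hi.preceq_of_flag_none hw hx.valid hx.not_mem_max hx.min_sub hx.sub_max hfn hc)
    · obtain ⟨y, hy⟩ := Option.ne_none_iff_exists'.1 hfn
      rcases π.weight_cases x with h0 | h1 | h2
      · exact .inl h0
      · refine .inr (hi.preceq_of_light hw ha hx.valid hx.not_mem_max hx.min_sub hx.sub_max h1
          (hi.flag y hy).2.2 hc fun p hp => ?_)
        rw [hcb, Option.some.injEq] at hp
        exact hp ▸ hold
      · exact absurd (hheavy h2) hfn
  have hadv : ∀ b c, c.parent = some b → Preceq c (tip s.C) → π.Old s.min b →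
      π.advOf s' c = π.advOf s c := fun b c hcb hc hold =>
    hx.adv_eq_of_preceq hw hi.toGraphInv hf (ne_genesis_of_parent hcb)
      (hfollow b c hcb hc hold)
  refine stepBound_of_le hw hi h (by rw [hx.min_eq, hf])
    (hx.max_eq ▸ Finset.subset_insert _ _) ?_ ?_ ?_
  · intro b e1 _ hold
    -- The value `-1` does not occur here, because the tip would have to be old.
    have hδ' : 0 ≤ δ := hδ.resolve_right fun h' =>
      hi.not_old_tip_of_light hw ha hx.valid hx.not_mem_max hx.min_sub hx.sub_max h'.1
        (ne_one_of_not_spe hw hs h'.2.1) h'.2.1 (e1 ▸ hold)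
    have h0 : π.malW s' s.S b = 0 := by
      rw [hx.malW_eq hi.toGraphInv, malW,
        Finset.sdiff_eq_empty_iff_subset.2 (e1 ▸ hi.special), totalW, Finset.sum_empty]
    linarith [hx.Pwith_le hw b]
  · intro b c hcb hc _ hold
    rw [hadv b c hcb hc hold, hx.malW_eq hi.toGraphInv]
    have h1 := hx.Pwith_le hw b
    have h2 : Min.min (π.lightW s c) (π.sh : ℝ) - δ ≤ Min.min (π.lightW s' c) π.sh := by
      rcases hδ with hδ | ⟨hx1, hspe, hδ⟩
      · exact (sub_le_self _ hδ).trans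
          (min_le_min_right _ (hx.lightW_le hw hi.toGraphInv c))
      · have hcx : Preceq c x := (hfollow b c hcb hc hold).resolve_left (by rw [hx1]; simp)
        rw [hx.lightW_eq_add_one hi.toGraphInv hx1 hcx, hδ]
        have h3 := lightW_le_card (π := π) s c
        rw [Spe, not_or, not_or, not_le, not_le, not_le] at hspe
        have h4 : (((s.delta \ s.M).filter fun b => π.weight b = 1).card : ℝ) + 1 ≤ π.sh := by
          exact_mod_cast hspe.2.1
        -- Fewer than `sh` light blocks were unknown, so the cap is inactive before and after, and
        -- the new block counts fully.
        rw [min_eq_left (by linarith), min_eq_left (by linarith)]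
        linarith
    linarith
  · intro b c hcb hc _ hold hneg
    rw [hadv b c hcb hc hold] at hneg
    exact absurd ((hi.dom c hc).resolve_left (ne_genesis_of_parent hcb)).2.2 (not_lt.2 hneg)

/-- Honest block generation that clears the flag block. -/
theorem stepBound_hGenRls_of_flag_none (hw : 0 < π.ηw) (hi : π.StateInv s)
    (hx : π.HonestStep s s' x) (h : π.ChainStep s s') (hf : s'.f = none) {δ : ℝ}
    (hδ : π.ηw ≤ δ) : π.StepBound s s' δ := by
  have hw' := weight_nonneg hw
  have hmin : s'.min ∪ s'.f.toFinset ⊆ s.min ∪ s.f.toFinset := by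
    rw [hx.min_eq, hf]
    simp
  have hmax : s.max ⊆ s'.max := hx.max_eq ▸ Finset.subset_insert _ _
  have hadv' : ∀ c, π.advOf s' c = subTW π.weight s.min c - sibSubTW π.weight s'.max c :=
    fun c => by rw [advOf, hf, adv_none, hx.min_eq]
  have hne : ∀ b c, c.parent = some b → π.Dom s c → b ≠ x := fun b c hcb hd e1 =>
    hx.not_mem_max (e1 ▸ hi.graph.mem_of_preceq ((Preceq.refl c).parent hcb) hd.1)
  -- Blocks that remain dominant without a flag also win in the past of `x`, so `x` extends them and
  -- strengthens none of their siblings.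
  have hfollow : ∀ c, Preceq c (tip s'.C) → Preceq c x := by
    intro c hc
    induction c using parent_induction with
    | genesis => exact genesis_preceq _
    | step c p hp ih =>
      have hpc : Preceq p c := (Preceq.refl c).parent hp
      have hd := h.dom hc (ne_genesis_of_parent hp)
      have hpos := hd.2.2
      rw [← advOf, hadv', sub_pos] at hpos
      exact hx.valid.preceq_of_dominant hw hx.min_sub hx.sub_max (ih (hpc.trans hc))
        (hne p c hp (hd.of_le hw hi.toGraphInv hmin hmax)) hp hd.2.1
        ((sibSubTW_mono hw' hmax).trans_lt hpos)
  have hsib : ∀ c, c ≠ genesis → Preceq c x →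
      π.advOf s' c = π.adv s.max s.min none c := fun c hc hcx => by
    rw [hadv', adv_none, hx.max_eq, hi.graph.sibSubTW_insert_of_preceq hw' hc hcx]
  refine stepBound_of_le hw hi h hmin hmax ?_ ?_ ?_
  · intro b e1 _ _
    have h0 : π.malW s' s.S b = 0 := by
      rw [hx.malW_eq hi.toGraphInv, malW,
        Finset.sdiff_eq_empty_iff_subset.2 (e1 ▸ hi.special), totalW, Finset.sum_empty]
    linarith [hx.Pwith_le hw b]
  · intro b c hcb _ hc' _
    have h1 := hi.adv_le_of_flag hw c
    rw [hx.malW_eq hi.toGraphInv, hsib c (ne_genesis_of_parent hcb) (hfollow c hc')]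
    have h2 : Min.min (π.lightW s c) (π.sh : ℝ) ≤ Min.min (π.lightW s' c) π.sh :=
      min_le_min_right _ (hx.lightW_le hw hi.toGraphInv c)
    linarith [hx.Pwith_le hw b]
  · intro b c hcb hc hb' _ hneg
    have hd := (hi.dom c hc).resolve_left (ne_genesis_of_parent hcb)
    have h1 := hi.adv_le_of_flag hw c
    -- Had `c` been positive without the flag, `x` would lie below it and `c` would not be cut.
    -- Hence its old `Adv` was at most the flag's weight.
    have h2 : π.adv s.max s.min none c ≤ 0 := by
      by_contra hpos
      have hpos' := not_le.1 hpos
      rw [adv_none, sub_pos] at hpos'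
      have hcx := hx.valid.preceq_of_dominant hw hx.min_sub hx.sub_max (hfollow b hb')
        (hne b c hcb hd) hcb hd.2.1 hpos'
      rw [hsib c (ne_genesis_of_parent hcb) hcx] at hneg
      exact hpos hneg
    linarith [hx.Pwith_le hw b]

/-- Honest block generation that creates a flag block. -/
theorem stepBound_hGenRls_of_flag_some (hw : 0 < π.ηw)
    (hs : 2 * (π.sh : ℝ) + 2 * π.sm ≤ π.ηw) (hi : π.StateInv s)
    (hx : π.HonestStep s s' x) (h : π.ChainStep s s') (hf : s'.f = some x)
    (hwx : π.weight x = π.ηw) (hspe : ¬ π.Spe s) (hheavy : ¬ π.HasHeavy s) :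
    π.StepBound s s' (2 * π.sh + 2 * π.sm - π.ηw) := by
  have hw' := weight_nonneg hw
  have hf0 : s.f = none := hi.flag_eq_none hheavy
  have hxmin : x ∉ s.min := fun hm => hx.not_mem_max (hi.min_sub hm)
  have hmf : s'.min ∪ s'.f.toFinset = insert x s.min := by
    rw [hf, hx.min_eq]
    ext y; simp
  have hmax : s.max ⊆ s'.max := hx.max_eq ▸ Finset.subset_insert _ _
  have hadv : ∀ c, c ≠ genesis → Preceq c x → π.advOf s' c =
      subTW π.weight s.min c - sibSubTW π.weight s.max c + π.ηw := fun c hc hcx => by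
    rw [advOf, adv, hmf, subTW_insert hcx hxmin, hx.max_eq,
      hi.graph.sibSubTW_insert_of_preceq hw' hc hcx, hwx]
    ring
  have hadv0 : ∀ c, π.advOf s c = subTW π.weight s.min c - sibSubTW π.weight s.max c :=
    fun c => by rw [advOf, hf0, adv_none]
  have hsub : ∀ c, Preceq c (tip s.C) → Preceq c x := fun c hc =>
    hi.preceq_of_flag_none hw hx.valid hx.not_mem_max hx.min_sub hx.sub_max hf0 hc
  -- If `x` is not below `c`, the flag does not help `c`; then `c` dominates by `min` alone, and `x`
  -- would have followed it.
  have hsub' : ∀ c, Preceq c (tip s'.C) → Preceq c x := by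
    intro c hc
    induction c using parent_induction with
    | genesis => exact genesis_preceq _
    | step c p hp ih =>
      by_contra hcx
      have hpc : Preceq p c := (Preceq.refl c).parent hp
      have hd := h.dom hc (ne_genesis_of_parent hp)
      have hcm : c ∈ s.max := by
        have := hd.1
        rw [hx.max_eq, Finset.mem_insert] at this
        exact this.resolve_left fun e1 => hcx (e1 ▸ Preceq.refl _)
      have hpos := hd.2.2
      rw [adv, hmf, subTW_insert_of_not_preceq hcx, sub_pos] at hpos
      exact hcx (hx.valid.preceq_of_dominant hw hx.min_sub hx.sub_max (ih (hpc.trans hc))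
        (fun e1 => hx.not_mem_max (e1 ▸ hi.graph.mem_of_preceq hpc hcm)) hp hd.2.1
        ((sibSubTW_mono hw' hmax).trans_lt hpos))
  have hsm : (0 : ℝ) ≤ π.sm := Nat.cast_nonneg _
  have hsh : (0 : ℝ) ≤ π.sh := Nat.cast_nonneg _
  -- On the chain of `x` no sibling is ahead in its past graph. Replacing that graph by `min` and
  -- `max` costs less than `sm + sh`, and the flag adds `ηw`; by `hs` the result exceeds `sm + sh`,
  -- so the new chain continues after every old block.
  have hkey : ∀ b, Preceq (tip s.C) b → Preceq b (tip s'.C) → π.Old s.min b →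
      ∃ c, c.parent = some b ∧ Preceq c (tip s'.C) ∧
        π.ηw - π.sm - π.sh < π.advOf s' c := by
    intro b htb hb' hold
    have hbx : b ≠ x := fun e1 => not_old_of_subset_past (e1 ▸ hx.min_sub) hold
    obtain ⟨c, hcb, hcx⟩ := exists_child_of_preceq (hsub' b hb') hbx
    have h1 := sub_sibSubTW_le (isGraph_past hx.valid.1) hw' hx.min_sub hx.sub_max hcb
    have h2 := hx.valid.sibSubTW_le_subTW hw hcx hcb
    have h3 : subTW π.weight (s.max \ s.min) b ≤ subTW π.weight s.delta (tip s.C) :=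
      subTW_mono hw' le_rfl htb
    have h4 := subTW_delta_lt_of_not_hasHeavy hw hspe hheavy
    have h5 := hadv c (ne_genesis_of_parent hcb) hcx
    have h6 : π.ηw - π.sm - π.sh < π.advOf s' c := by linarith
    obtain ⟨p, hp⟩ := exists_parent hx.valid.1
    have hcm : c ∈ s'.max ∧ 0 < π.weight c := by
      rcases (preceq_iff_of_parent hp).1 hcx with hcp | rfl
      · have hm := mem_chldn.1 (bestChild_eq_some (hx.valid.bestChild_eq hp hcp hcb)).1
        exact ⟨hmax (hx.sub_max hm.1), hm.2.2⟩
      · rw [hx.max_eq, hwx]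
        exact ⟨Finset.mem_insert_self _ _, hw⟩
    exact ⟨c, hcb, h.extend hb' hcb ⟨hcm.1, hcm.2, by rw [← advOf]; linarith⟩
      fun _ => by linarith, h6⟩
  refine stepBound_of_keep hw hi h ?_ (hx.Pwith_le hw) (hx.subT_inter_M hi.toGraphInv _).le
    ?_ ?_ ?_
  · intro c hcg hc
    have hd := (hi.dom c hc).resolve_left hcg
    refine ⟨hmax hd.1, hd.2.1, ?_⟩
    have hpos := hd.2.2
    rw [← advOf, hadv0] at hpos
    rw [← advOf, hadv c hcg (hsub c hc)]
    linarith
  · intro b c hcb hc _ _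
    rw [hadv c (ne_genesis_of_parent hcb) (hsub c hc), hadv0, hx.malW_eq hi.toGraphInv]
    have h2 : Min.min (π.lightW s c) (π.sh : ℝ) ≤ Min.min (π.lightW s' c) π.sh :=
      min_le_min_right _ (hx.lightW_le hw hi.toGraphInv c)
    linarith [hx.Pwith_le hw b]
  -- The value may be negative, so this case has to be void: an old tip would have been extended.
  · intro htt hold
    obtain ⟨c, hcb, hc, -⟩ := hkey _ htt (Preceq.refl _) hold
    exact absurd hc (not_preceq_parent hcb)
  · intro b c hcb htb hc hold
    obtain ⟨d, hdb, hd, hlt⟩ := hkey b htb (((Preceq.refl c).parent hcb).trans hc) hold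
    rw [eq_of_preceq_of_parent hc hd hcb hdb]
    linarith

/-- The fate of the flag decides. If it is unchanged, a nonnegative value suffices except for a
light block outside the special status, whose value is `-1`. -/
theorem stepBound_hGenRls (hw : 0 < π.ηw) (hs : 2 * (π.sh : ℝ) + 2 * π.sm ≤ π.ηw)
    (ha : 2 * (π.sm : ℝ) + 2 * π.sh + 2 * π.ηw ≤ π.ηa) (hi : π.StateInv s)
    (he : π.Admissible s e) (ht : e.type = .hGenRls) :
    π.StepBound s (π.ψ s e) (π.eventValue s e) := by
  have hg := hi.toGraphInv.step hw hs he
  have hx := honestStep_ψ he ht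
  have h := chainStep_ψ hw hg
  have hval : π.eventValue s e = if π.weight e.block = 0 then 0
      else if π.weight e.block = 1 then (if π.Spe s then 0 else -1)
      else if ¬ π.HasHeavy s then (if π.Spe s then 0 else 2 * π.sh + 2 * π.sm - π.ηw)
      else if s.f = none then 0
      else π.ηw + π.sm := by simp only [eventValue, ht]
  by_cases hfl : π.Flagging s e
  · have hne1 := ne_one_of_not_spe hw hs hfl.2.2.1
    rw [hval, if_neg (by rw [hfl.2.1]; exact hw.ne'), if_neg (by rw [hfl.2.1]; exact hne1),
      if_pos hfl.2.2.2, if_neg hfl.2.2.1]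
    exact stepBound_hGenRls_of_flag_some hw hs hi hx h (newFlag_of_flagging hfl) hfl.2.1
      hfl.2.2.1 hfl.2.2.2
  · rcases newFlag_hGenRls ht hfl with ⟨hf, hheavy⟩ | ⟨hf, hwx, hne⟩
    · refine stepBound_hGenRls_of_flag_eq hw hs ha hi hx h hf hheavy ?_
      rw [hval]
      split_ifs with h0 h1 h2 h2 h3 h3
      · exact .inl le_rfl
      · exact .inl le_rfl
      · exact .inr ⟨h1, h2, rfl⟩
      · exact .inl le_rfl
      · exact .inl (add_nonneg hw.le (Nat.cast_nonneg _))
      · exact .inl le_rfl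
      · exact absurd ⟨ht, ((π.weight_cases _).resolve_left h0).resolve_left h1, h3, h2⟩ hfl
    · obtain ⟨y, hy⟩ := Option.ne_none_iff_exists'.1 hne
      obtain ⟨hy1, hy2, hy3⟩ := hi.flag y hy
      refine stepBound_hGenRls_of_flag_none hw hi hx h hf ?_
      rw [hval, if_neg (by rw [hwx]; exact hw.ne'), if_neg (by rw [hwx]; exact hy3),
        if_neg (not_not.2 ⟨y, hy1, hy2⟩), if_neg hne]
      exact le_add_of_nonneg_right (Nat.cast_nonneg _)

/-- The change of the potential under an admissible event. -/
theorem stepBound_ψ (hw : 0 < π.ηw) (hs : 2 * (π.sh : ℝ) + 2 * π.sm ≤ π.ηw)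
    (ha : 2 * (π.sm : ℝ) + 2 * π.sh + 2 * π.ηw ≤ π.ηa) (hi : π.StateInv s)
    (he : π.Admissible s e) : π.StepBound s (π.ψ s e) (π.eventValue s e) := by
  have hg := hi.toGraphInv.step hw hs he
  rcases e.type.eq_or with ht | ht | ht | ht
  · exact stepBound_hGenRls hw hs ha hi he ht
  · exact stepBound_mGen hw hi he hg ht
  · exact stepBound_mRls hw hi he hg ht
  · exact stepBound_arvl hw hi hg ht

end honest

end Params

/-! ## Executions -/

theorem mem_ite_insert {α : Type*} [DecidableEq α] {p : Prop} [Decidable p] {a x : α}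
    {A : Finset α} : (x ∈ if p then insert a A else A) ↔ (p ∧ x = a) ∨ x ∈ A := by
  split_ifs with h <;> simp [h]

namespace Execution

variable {π : Params} {ι : Type*} (X : Execution π ι) {n i j : ℕ} {b : Block}

theorem state_succ (hn : n < X.events.length) :
    X.state (n + 1) = π.ψ (X.state n) X.events[n] := by
  rw [state, List.take_succ_eq_append_getElem hn, List.foldl_append]
  rfl

/-- The block is the block of one of the first `n` events, of the given kind. -/
def Occurs (n : ℕ) (p : Event → Prop) (b : Block) : Prop :=
  ∃ k, ∃ hk : k < X.events.length, k < n ∧ p X.events[k] ∧ X.events[k].block = b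

theorem occurs_succ (hn : n < X.events.length) (p : Event → Prop) :
    X.Occurs (n + 1) p b ↔ (p X.events[n] ∧ b = X.events[n].block) ∨ X.Occurs n p b := by
  constructor
  · rintro ⟨k, hk, hkn, hp, rfl⟩
    rcases Nat.lt_succ_iff_lt_or_eq.1 hkn with h | rfl
    · exact .inr ⟨k, hk, h, hp, rfl⟩
    · exact .inl ⟨hp, rfl⟩
  · rintro (⟨hp, rfl⟩ | ⟨k, hk, hkn, hp, rfl⟩)
    · exact ⟨n, hn, n.lt_succ_self, hp, rfl⟩
    · exact ⟨k, hk, hkn.trans n.lt_succ_self, hp, rfl⟩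

/-- Membership in the recursively built graphs becomes the existence of an earlier event, to which
the rules of the execution apply. -/
theorem mem_state (hn : n ≤ X.events.length) (b : Block) :
    (b ∈ (X.state n).gen ↔ b = genesis ∨ X.Occurs n Event.IsGen b) ∧
    (b ∈ (X.state n).max ↔ b = genesis ∨ X.Occurs n Event.IsRls b) ∧
    (b ∈ (X.state n).min ↔ b = genesis ∨ X.Occurs n (fun e => e.type = .arvl) b) ∧
    (b ∈ (X.state n).M ↔ X.Occurs n (fun e => e.type = .mGen) b) := by
  induction n with
  | zero => simp [state, AdvState.init, Occurs]
  | succ n ih =>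
    obtain ⟨h1, h2, h3, h4⟩ := ih (Nat.le_of_succ_le hn)
    have hn' : n < X.events.length := hn
    rw [X.state_succ hn', X.occurs_succ hn', X.occurs_succ hn', X.occurs_succ hn',
      X.occurs_succ hn']
    simp only [Params.ψ]
    rw [mem_ite_insert, mem_ite_insert, mem_ite_insert, mem_ite_insert, h1, h2, h3, h4]
    exact ⟨or_left_comm, or_left_comm, or_left_comm, Iff.rfl⟩

/-! ### Uniqueness and order of events -/

theorem lt_of_mustPrecede (hi : i < X.events.length) (hj : j < X.events.length)
    (h : X.events[i].MustPrecede X.events[j]) (hne : X.events[i] ≠ X.events[j]) : i < j := by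
  rcases lt_trichotomy i j with h' | rfl | h'
  · exact h'
  · exact absurd rfl hne
  · exact absurd h (List.pairwise_iff_getElem.1 X.ordered j i hj hi h')

theorem eq_of_isGen (hi : i < X.events.length) (hj : j < X.events.length)
    (hgi : X.events[i].IsGen) (hgj : X.events[j].IsGen)
    (h : X.events[i].block = X.events[j].block) : i = j := by
  rcases lt_trichotomy i j with h' | h' | h'
  · exact absurd h ((List.pairwise_iff_getElem.1 X.nodup i j hi hj h').2 hgi hgj)
  · exact h'
  · exact absurd h.symm ((List.pairwise_iff_getElem.1 X.nodup j i hj hi h').2 hgj hgi)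

theorem eq_of_getElem_eq (hi : i < X.events.length) (hj : j < X.events.length)
    (h : X.events[i] = X.events[j]) : i = j := by
  rcases lt_trichotomy i j with h' | h' | h'
  · exact absurd h (List.pairwise_iff_getElem.1 X.nodup i j hi hj h').1
  · exact h'
  · exact absurd h.symm (List.pairwise_iff_getElem.1 X.nodup j i hj hi h').1

theorem not_mustPrecede_of_le (hi : i < X.events.length) (hj : j < X.events.length)
    (hij : i < j) : ¬ X.events[j].MustPrecede X.events[i] :=
  List.pairwise_iff_getElem.1 X.ordered i j hi hj hij

theorem round_le (hi : i < X.events.length) (hj : j < X.events.length) (hij : i < j) :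
    X.events[i].round ≤ X.events[j].round :=
  not_lt.1 fun h => X.not_mustPrecede_of_le hi hj hij (.inl h)

theorem ne_genesis (hj : j < X.events.length) (hg : X.events[j].IsGen) :
    X.events[j].block ≠ genesis := by
  have hm := List.getElem_mem hj
  rcases h : X.events[j] with ⟨r, b, t⟩
  rw [h] at hm hg
  rcases hg with rfl | rfl
  · obtain ⟨hr, i, hi, hb⟩ := (X.hGenRls_iff r b).1 hm
    exact (X.mined_valid r hr i hi b hb).1.1
  · exact (X.mGen_valid r b hm).2.1.1

/-- A released block was generated before, in an earlier round or by the same event. -/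
theorem exists_gen_of_rls (hj : j < X.events.length) (h : X.events[j].IsRls) :
    ∃ i, ∃ hi : i < X.events.length, X.events[i].IsGen ∧
      X.events[i].block = X.events[j].block ∧
      (X.events[j].type = .hGenRls ∧ i = j ∨
        X.events[i].type = .mGen ∧ X.events[i].round < X.events[j].round) := by
  rcases h with h | h
  · exact ⟨j, hj, .inl h, rfl, .inl ⟨h, rfl⟩⟩
  · have hm := List.getElem_mem hj
    rcases he : X.events[j] with ⟨r, b, t⟩
    rw [he] at hm h
    subst h
    obtain ⟨hr, ⟨e, hem, het, rfl⟩, ⟨i, hi, hb⟩, -⟩ := (X.mRls_iff r b).1 hm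
    obtain ⟨k, hk, rfl⟩ := List.getElem_of_mem hem
    obtain ⟨e', hem', hg', hb', hr'⟩ := X.loc_generated r hr i hi _ hb
      (X.ne_genesis hk (.inr het))
    obtain ⟨k', hk', rfl⟩ := List.getElem_of_mem hem'
    have := X.eq_of_isGen hk' hk hg' (.inr het) hb'
    subst this
    exact ⟨k', hk', hg', rfl, .inr ⟨het, hr'⟩⟩

/-- The blocks of an honest local state were released before. -/
theorem exists_rls_of_mem_loc {r : ℕ} (hr : r ≤ X.rmax) {i : ι} (hi : i ∈ X.honest r)
    (hb : b ∈ X.loc r i) (hg : b ≠ genesis) :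
    ∃ k, ∃ hk : k < X.events.length, X.events[k].block = b ∧
      (X.events[k].type = .hGenRls ∧ X.events[k].round < r ∨
        X.events[k].type = .mRls ∧ X.events[k].round ≤ r) := by
  obtain ⟨e, hem, heg, rfl, her⟩ := X.loc_generated r hr i hi b hb hg
  rcases heg with het | het
  · obtain ⟨k, hk, rfl⟩ := List.getElem_of_mem hem
    exact ⟨k, hk, rfl, .inl ⟨het, her⟩⟩
  -- The first round in which some honest node holds the malicious block is the round of its
  -- release.
  · have hex : ∃ r, ∃ i ∈ X.honest r, e.block ∈ X.loc r i := ⟨r, i, hi, hb⟩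
    have hle : Nat.find hex ≤ r := Nat.find_min' hex ⟨i, hi, hb⟩
    have hm := (X.mRls_iff (Nat.find hex) e.block).2 ⟨hle.trans hr, ⟨e, hem, het, rfl⟩,
      Nat.find_spec hex, fun r' hr' j hj hbj => Nat.find_min hex hr' ⟨j, hj, hbj⟩⟩
    obtain ⟨k, hk, hke⟩ := List.getElem_of_mem hm
    exact ⟨k, hk, by rw [hke], .inr ⟨by rw [hke], by rw [hke]; exact hle⟩⟩

/-- A block is generated once, and a malicious block strictly before the round of its release, so no
release can be listed before the generation. -/
theorem not_mem_max_of_gen (hn : n < X.events.length) (hg : X.events[n].IsGen) :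
    X.events[n].block ∉ (X.state n).max := by
  rw [(X.mem_state hn.le _).2.1, not_or]
  refine ⟨X.ne_genesis hn hg, ?_⟩
  rintro ⟨k, hk, hkn, hr, hb⟩
  obtain ⟨i, hi, hig, hib, h | h⟩ := X.exists_gen_of_rls hk hr
  · have := X.eq_of_isGen hi hn hig hg (hib.trans hb)
    omega
  · have := X.eq_of_isGen hi hn hig hg (hib.trans hb)
    subst this
    exact (X.round_le hk hi hkn).not_gt h.2

/-- An arrival takes place `d` rounds after a release, and a release puts the block into some honest
local state; the delivery rule then reaches every honest node. -/
theorem min_subset_loc (hn : n < X.events.length)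
    {i : ι} (hi : i ∈ X.honest X.events[n].round) (hr : X.events[n].round ≤ X.rmax) :
    (X.state n).min ⊆ X.loc X.events[n].round i := by
  intro y hy
  rw [(X.mem_state hn.le _).2.2.1] at hy
  rcases hy with rfl | ⟨k, hk, hkn, hkt, rfl⟩
  · exact (X.loc_isGraph _ hr i hi).1
  · have hle := X.round_le hk hn hkn
    have hm := List.getElem_mem hk
    rcases he : X.events[k] with ⟨r0, b, t⟩
    rw [he] at hm hkt hle
    dsimp only at hkt hle
    subst hkt
    obtain ⟨-, ⟨r1, b1, t1⟩, hem, hrls, hb, hrd⟩ := (X.arvl_iff r0 b).1 hm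
    dsimp only at hb hrd
    subst hb
    have hle' : r1 + X.d ≤ X.events[n].round := hrd ▸ hle
    rcases hrls with h | h <;> dsimp only at h <;> subst h
    · obtain ⟨-, j, hj, hmj⟩ := (X.hGenRls_iff r1 b1).1 hem
      refine X.delivery r1 _ hle' hr j hj i hi (Finset.mem_union_right _ ?_)
      simp [hmj]
    · obtain ⟨-, -, ⟨j, hj, hbj⟩, -⟩ := (X.mRls_iff r1 b1).1 hem
      exact X.delivery r1 _ hle' hr j hj i hi (Finset.mem_union_left _ hbj)

/-- Honest blocks in a local state come from earlier rounds; malicious ones were released in this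
round at the latest, and releases precede honest generation within a round. -/
theorem loc_subset_max (hn : n < X.events.length) (ht : X.events[n].type = .hGenRls)
    {i : ι} (hi : i ∈ X.honest X.events[n].round) (hr : X.events[n].round ≤ X.rmax) :
    X.loc X.events[n].round i ⊆ (X.state n).max := by
  intro y hy
  rw [(X.mem_state hn.le _).2.1]
  by_cases hg : y = genesis
  · exact .inl hg
  · obtain ⟨k, hk, hb, h | h⟩ := X.exists_rls_of_mem_loc hr hi hy hg
    · have hlt := X.lt_of_mustPrecede hk hn (.inl h.2) fun e => by
        have := h.2; rw [e] at this; exact this.false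
      exact .inr ⟨k, hk, hlt, .inl h.1, hb⟩
    · have hne : X.events[k] ≠ X.events[n] := fun e => by
        have := h.1; rw [e, ht] at this; cases this
      refine .inr ⟨k, hk, X.lt_of_mustPrecede hk hn ?_ hne, .inr h.1, hb⟩
      rcases h.2.lt_or_eq with h' | h'
      · exact .inl h'
      · exact .inr (.inl ⟨h', by rw [h.1, ht]; decide⟩)

/-- The local state in which the block appears is a graph, so it contains the past; dependencies
released in the same round are listed earlier. -/
theorem past_subset_max_of_mRls (hn : n < X.events.length) (ht : X.events[n].type = .mRls) :
    X.events[n].block.past ⊆ (X.state n).max := by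
  have hm := List.getElem_mem hn
  intro y hy
  rw [(X.mem_state hn.le _).2.1]
  by_cases hg : y = genesis
  · exact .inl hg
  have hmem : ∃ hr : X.events[n].round ≤ X.rmax, ∃ i ∈ X.honest X.events[n].round,
      y ∈ X.loc X.events[n].round i := by
    rcases he : X.events[n] with ⟨r, b, t⟩
    rw [he] at hm ht hy
    dsimp only at ht hy
    subst ht
    obtain ⟨hr, -, ⟨i, hi, hbi⟩, -⟩ := (X.mRls_iff r b).1 hm
    exact ⟨hr, i, hi, (X.loc_isGraph r hr i hi).2 b hbi hy⟩
  obtain ⟨hr, i, hi, hyi⟩ := hmem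
  obtain ⟨k, hk, hb, h | h⟩ := X.exists_rls_of_mem_loc hr hi hyi hg
  · have hlt := X.lt_of_mustPrecede hk hn (.inl h.2) fun e => by
      have := h.2; rw [e] at this; exact this.false
    exact .inr ⟨k, hk, hlt, .inl h.1, hb⟩
  · have hne : X.events[k] ≠ X.events[n] := fun e => by
      rw [← hb, e] at hy; exact mem_past_irrefl _ hy
    refine .inr ⟨k, hk, X.lt_of_mustPrecede hk hn ?_ hne, .inr h.1, hb⟩
    exact .inr (.inr (.inl ⟨.inl (h.1.trans ht.symm), hb ▸ hy⟩))

/-- Every event of an execution is admissible. -/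
theorem admissible (hn : n < X.events.length) :
    π.Admissible (X.state n) X.events[n] where
  hGenRls ht := by
    have hgen : X.events[n].IsGen := .inl ht
    have hm := List.getElem_mem hn
    have hmined : X.events[n].round ≤ X.rmax ∧ ∃ i ∈ X.honest X.events[n].round,
        X.mined X.events[n].round i = some X.events[n].block := by
      rcases he : X.events[n] with ⟨r, b, t⟩
      rw [he] at hm ht
      dsimp only at ht
      subst ht
      exact (X.hGenRls_iff r b).1 hm
    obtain ⟨hr, i, hi, hmi⟩ := hmined
    obtain ⟨hv, hp⟩ := X.mined_valid _ hr i hi _ hmi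
    refine ⟨hv, X.not_mem_max_of_gen hn hgen, ?_, ?_, ?_⟩
    · rw [(X.mem_state hn.le _).2.2.2]
      rintro ⟨k, hk, hkn, hkg, hkb⟩
      exact hkn.ne (X.eq_of_isGen hk hn (.inr hkg) hgen hkb)
    · rw [hp]; exact X.min_subset_loc hn hi hr
    · rw [hp]; exact X.loc_subset_max hn ht hi hr
  mGen ht := X.not_mem_max_of_gen hn (.inr ht)
  mRls ht := by
    obtain ⟨i, hi, hig, hib, h | h⟩ := X.exists_gen_of_rls hn (.inr ht)
    · rw [h.1] at ht; cases ht
    have hin : i < n := X.lt_of_mustPrecede hi hn (.inl h.2) fun e => by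
      have := h.2; rw [e] at this; exact this.false
    refine ⟨?_, ?_, ?_, X.past_subset_max_of_mRls hn ht⟩
    · rw [(X.mem_state hn.le _).1]
      exact .inr ⟨i, hi, hin, hig, hib⟩
    · rw [(X.mem_state hn.le _).2.2.2]
      exact ⟨i, hi, hin, h.1, hib⟩
    · rw [(X.mem_state hn.le _).2.1, not_or, ← hib]
      refine ⟨X.ne_genesis hi hig, ?_⟩
      rintro ⟨k, hk, hkn, hkr | hkr, hkb⟩
      · have := X.eq_of_isGen hk hi (.inl hkr) hig hkb
        subst this
        rw [h.1] at hkr; cases hkr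
      -- Two releases of one block would both mark its first appearance, so they share the round and
      -- are the same event.
      · refine hkn.ne (X.eq_of_getElem_eq hk hn ?_)
        have hmk := List.getElem_mem hk
        have hmn := List.getElem_mem hn
        rw [hib] at hkb
        revert hmk hmn hkr ht hkb
        generalize X.events[k] = e1
        generalize X.events[n] = e2
        obtain ⟨r1, b1, t1⟩ := e1
        obtain ⟨r2, b2, t2⟩ := e2
        rintro ⟨⟩ ⟨⟩ ⟨⟩ hm1 hm2
        obtain ⟨-, -, ⟨i1, hi1, hb1⟩, hmin1⟩ := (X.mRls_iff _ _).1 hm1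
        obtain ⟨-, -, ⟨i2, hi2, hb2⟩, hmin2⟩ := (X.mRls_iff _ _).1 hm2
        have hr : r1 = r2 := by
          rcases lt_trichotomy r1 r2 with hlt | heq | hlt
          · exact absurd hb1 (hmin2 r1 hlt i1 hi1)
          · exact heq
          · exact absurd hb2 (hmin1 r2 hlt i2 hi2)
        rw [hr]
  arvl ht := by
    have hm := List.getElem_mem hn
    have hrls : ∃ k, ∃ hk : k < X.events.length, X.events[k].IsRls ∧
        X.events[k].block = X.events[n].block := by
      rcases he : X.events[n] with ⟨r, b, t⟩
      rw [he] at hm ht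
      dsimp only at ht
      subst ht
      obtain ⟨-, e, hem, hr, hb, -⟩ := (X.arvl_iff r b).1 hm
      obtain ⟨k, hk, rfl⟩ := List.getElem_of_mem hem
      exact ⟨k, hk, hr, hb⟩
    obtain ⟨k, hk, hkr, hkb⟩ := hrls
    rw [(X.mem_state hn.le _).2.1]
    refine .inr ⟨k, hk, X.lt_of_mustPrecede hk hn (.inr (.inr (.inr ⟨hkr, ht, hkb⟩))) ?_,
      hkr, hkb⟩
    intro e
    rw [e, Event.IsRls, ht] at hkr
    rcases hkr with h | h <;> cases h

/-! ### The invariants along an execution -/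

theorem stateInv_init (π : Params) : π.StateInv AdvState.init where
  graph := ⟨Finset.mem_singleton_self _, fun b hb => by
    rw [AdvState.init, Finset.mem_singleton] at hb
    subst hb; simp [past]⟩
  min_sub := le_rfl
  flag y hy := by cases hy
  chain := by simp [AdvState.init, tip, Block.chain]
  dom b hb := by
    left
    simpa [AdvState.init, tip, preceq_genesis_iff] using hb
  maximal c hc hd := by
    have := hd.1
    rw [AdvState.init, Finset.mem_singleton] at this
    exact absurd this (ne_genesis_of_parent hc)
  special := by simp [AdvState.init]

theorem stateInv (hw : 0 < π.ηw) (hs : 2 * (π.sh : ℝ) + 2 * π.sm ≤ π.ηw)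
    (hn : n ≤ X.events.length) : π.StateInv (X.state n) := by
  induction n with
  | zero => exact stateInv_init π
  | succ n ih =>
    have hn' : n < X.events.length := hn
    have hg := (ih hn'.le).toGraphInv.step hw hs (X.admissible hn')
    rw [X.state_succ hn']
    exact (Params.chainStep_ψ hw hg).stateInv hg

end Execution

end Ghast

/-! ### The main theorem -/

theorem mainTheorem4 (π : Ghast.Params) (hw : 0 < π.ηw)
    (hs : 2 * (π.sh : ℝ) + 2 * π.sm ≤ π.ηw)
    (ha : 2 * (π.sm : ℝ) + 2 * π.sh + 2 * π.ηw ≤ π.ηa)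
    {ι : Type*} (X : Ghast.Execution π ι) (n : ℕ) (hn : n < X.events.length) :
    (∀ (b : Ghast.Block) (p p' : ℝ),
      π.P (X.state n) b = some p → π.P (X.state (n + 1)) b = some p' →
      (p' + (X.state (n + 1)).v) - (p + (X.state n).v)
        ≤ π.eventValue (X.state n) X.events[n]) ∧
    (∀ (b : Ghast.Block) (p' : ℝ),
      π.P (X.state n) b = none → π.P (X.state (n + 1)) b = some p' →
      π.Old (X.state n).min b →
      ∃ p : ℝ, π.P (X.state n) (Ghast.tip (X.state n).C) = some p ∧
        (p' + (X.state (n + 1)).v) - (p + (X.state n).v)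
          ≤ π.eventValue (X.state n) X.events[n]) := by
  have hi := X.stateInv hw hs hn.le
  have hi' := X.stateInv hw hs hn
  have hb := Ghast.Params.stepBound_ψ hw hs ha hi (X.admissible hn)
  rw [← X.state_succ hn] at hb
  refine ⟨fun b p p' hp hp' => ?_, fun b p' hp hp' hold => ?_⟩
  · rw [Ghast.Params.P_eq_some_iff hi.chain] at hp
    rw [Ghast.Params.P_eq_some_iff hi'.chain] at hp'
    obtain ⟨⟨h1, h2⟩, rfl⟩ := hp
    obtain ⟨⟨h3, -⟩, rfl⟩ := hp'
    exact hb.both b h1 h3 h2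
  · rw [Ghast.Params.P_eq_none_iff hi.chain] at hp
    rw [Ghast.Params.P_eq_some_iff hi'.chain] at hp'
    obtain ⟨⟨h3, -⟩, rfl⟩ := hp'
    -- As `b` is old in the earlier `min`, its potential can be undefined only because `b` was off
    -- the chain; the old tip precedes `b` and is therefore old as well.
    obtain ⟨h4, h5⟩ := hb.new b (fun h => hp ⟨h, hold⟩) h3 hold
    exact ⟨_, (Ghast.Params.P_eq_some_iff hi.chain).2
      ⟨⟨Ghast.Preceq.refl _, hold.mono le_rfl h4⟩, rfl⟩, h5⟩
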